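/- For $b\in\mathbb R^9$ let $L_b$ denote the translation $x\mapsto x+b$, let $e_1,\dots,e_9$ be the canonical basis and $\Lambda=\mathbb Z e_1+\dots+\mathbb Z e_9$. Put $$B=\mathrm{diag}(1,1,1,-1,-1,-1,-1,-1,-1),\qquad B'=\mathrm{diag}(1,1,1,1,1,1,-1,-1,-1),$$ and let $\Gamma=\langle BL_{e_1/2},\,L_\lambda:\lambda\in\Lambda\rangle$ and $\Gamma'=\langle B'L_{e_1/2},\,L_\lambda:\lambda\in\Lambda\rangle$, as subgroups of the isometry group $I(\mathbb R^9)$. Let $M=\Gamma\backslash\mathbb R^9$ and $M'=\Gamma'\backslash\mathbb R^9$, with the metrics induced from $\mathbb R^9$. Two compact Riemannian manifolds are called $p$-isospectral if their Hodge Laplacians on smooth $p$-forms have the same eigenvalues with the same multiplicities. For a discrete cocompact torsion-free group $G\subset I(\mathbb R^9)$, let $d_{p,\mu}(G)$ be the multiplicity of the eigenvalue $4\pi^2\mu$ of the (non-negative) Hodge Laplacian on $p$-forms on $G\backslash\mathbb R^9$. For integers $0\le l,j\le n$ let $$K_l^n(j)=\sum_{t=0}^{l}(-1)^t\binom jt\binom{n-j}{l-t}.$$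 Then: 1. $\Gamma$ and $\Gamma'$ are Bieberbach groups (discrete, cocompact and torsion-free) with translation lattice $\Lambda$, so $M$ and $M'$ are compact flat $9$-manifolds; both have holonomy group isomorphic to $\mathbb Z_2$. 2. $M$ is orientable and $M'$ is not orientable. 3. For $0\le p\le 9$, $M$ and $M'$ are $p$-isospectral if and only if $p=2$ or $p=7$. 4. The Betti numbers $\beta_0,\dots,\beta_9$ are $1,3,18,46,60,60,46,18,3,1$ for $M$ and $1,6,18,38,60,66,46,18,3,0$ for $M'$. 5. $d_{0,1}(\Gamma)<d_{0,1}(\Gamma')$, and $d_{p,1}(\Gamma)\ne d_{p,1}(\Gamma')$ for $p=4,6,8$. 6. For odd $n<9$ no $K_l^n(j)$ with $0\le l,j\le n$ vanishes; for $0\le l,j\le 9$, $K_l^9(j)=0$ if and only if $(l,j)$ is one of $(2,3),(2,6),(3,2),(3,7),(6,2),(6,7),(7,3),(7,6)$. -/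

import Mathlib

noncomputable section

namespace FlatForms

open scoped ContDiff

/-- Euclidean space `ℝⁿ`. -/
abbrev E (n : ℕ) : Type := EuclideanSpace ℝ (Fin n)

/-- The group `I(ℝⁿ)` of isometries of `ℝⁿ` (composition is the product). -/
abbrev Isom (n : ℕ) : Type := E n ≃ᵃⁱ[ℝ] E n

/-! ### Bieberbach groups and compact flat manifolds -/

/-- Points in the same `Γ`-orbit. -/
def orbitSetoid {n : ℕ} (Γ : Subgroup (Isom n)) : Setoid (E n) where
  r x y := ∃ γ ∈ Γ, γ x = y
  iseqv :=
    { refl := fun x => ⟨1, Γ.one_mem, rfl⟩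
      symm := by
        rintro x y ⟨γ, hγ, rfl⟩
        exact ⟨γ⁻¹, Γ.inv_mem hγ, γ.symm_apply_apply x⟩
      trans := by
        rintro x y z ⟨γ, hγ, rfl⟩ ⟨δ, hδ, rfl⟩
        exact ⟨δ * γ, Γ.mul_mem hδ hγ, rfl⟩ }

/-- The quotient `M_Γ = Γ\ℝⁿ`, with the quotient topology. -/
abbrev FlatQuotient {n : ℕ} (Γ : Subgroup (Isom n)) : Type := Quotient (orbitSetoid Γ)

/-- `Γ ⊆ I(ℝⁿ)` is a Bieberbach group: discrete (for the topology of pointwise convergence, which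
is the usual topology of `I(ℝⁿ)`), cocompact and torsion-free. -/
structure IsBieberbach {n : ℕ} (Γ : Subgroup (Isom n)) : Prop where
  discrete : DiscreteTopology (Set.range fun γ : Γ => (γ.1 : E n → E n))
  cocompact : CompactSpace (FlatQuotient Γ)
  torsionFree : ∀ γ ∈ Γ, γ ≠ 1 → ¬ IsOfFinOrder γ

/-- The map `B L_b ↦ B` from `I(ℝⁿ)` to `O(n)`. -/
def linearPart (n : ℕ) : Isom n →* (E n ≃ₗᵢ[ℝ] E n) where
  toFun γ := γ.linearIsometryEquiv
  map_one' := rfl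
  map_mul' _ _ := rfl

/-- The point group of `Γ`, i.e. the group of linear parts of its elements. It is the (linear)
holonomy group of the flat manifold `Γ\ℝⁿ`: parallel transport in `ℝⁿ` is trivial, so the transport
along the loop in `Γ\ℝⁿ` that corresponds to `γ = B L_b` is `B` or its inverse. -/
def holonomyGroup {n : ℕ} (Γ : Subgroup (Isom n)) : Subgroup (E n ≃ₗᵢ[ℝ] E n) :=
  Γ.map (linearPart n)

/-- The translation `L_b : x ↦ b + x`. -/
def translation {n : ℕ} (b : E n) : Isom n := AffineIsometryEquiv.constVAdd ℝ (E n) b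

/-- The canonical lattice `Λ = ℤe₁ + ⋯ + ℤeₙ`. -/
def canonicalLattice (n : ℕ) : Submodule ℤ (E n) :=
  Submodule.span ℤ (Set.range fun i : Fin n => EuclideanSpace.single i (1 : ℝ))

/-! ### Differential forms on `Γ\ℝⁿ`

The projection `ℝⁿ → Γ\ℝⁿ` is a locally isometric covering with deck group `Γ`, so the smooth
`p`-forms on `Γ\ℝⁿ` are the smooth `p`-forms on `ℝⁿ` that satisfy `γ^* α = α` for all `γ ∈ Γ`, and
all natural operators on them are those of `ℝⁿ`. Coefficients are in `𝕜`, which will be `ℝ`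
or `ℂ`. -/

/-- A (not necessarily smooth) `p`-form on `ℝⁿ` with coefficients in `𝕜`. -/
abbrev Form (𝕜 : Type) [NormedAddCommGroup 𝕜] [NormedSpace ℝ 𝕜] (n p : ℕ) : Type :=
  E n → E n [⋀^Fin p]→L[ℝ] 𝕜

variable {𝕜 : Type} [NormedField 𝕜] [NormedAlgebra ℝ 𝕜] {n p : ℕ}

/-- The pullback `f^* α`. -/
def pullback (f : E n → E n) (α : Form 𝕜 n p) : Form 𝕜 n p := fun x =>
  (α (f x)).compContinuousLinearMap (fderiv ℝ f x)

/-- The space of smooth `p`-forms on `Γ\ℝⁿ`. -/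
def smoothForms (𝕜 : Type) [NormedField 𝕜] [NormedAlgebra ℝ 𝕜] {n : ℕ} (Γ : Subgroup (Isom n)) (p : ℕ) :
    Submodule 𝕜 (Form 𝕜 n p) where
  carrier := {α | ContDiff ℝ ∞ α ∧ ∀ γ ∈ Γ, pullback γ α = α}
  zero_mem' := ⟨contDiff_const, fun γ _ => by ext x v; simp [pullback]⟩
  add_mem' := by
    rintro α η ⟨hα, hα'⟩ ⟨hη, hη'⟩
    refine ⟨hα.add hη, fun γ hγ => ?_⟩
    ext x v
    have h1 := congrArg (fun ζ : Form 𝕜 n p => ζ x v) (hα' γ hγ)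
    have h2 := congrArg (fun ζ : Form 𝕜 n p => ζ x v) (hη' γ hγ)
    simp [pullback] at h1 h2 ⊢
    rw [h1, h2]
  smul_mem' := by
    rintro c α ⟨hα, hα'⟩
    refine ⟨hα.const_smul c, fun γ hγ => ?_⟩
    ext x v
    have h1 := congrArg (fun ζ : Form 𝕜 n p => ζ x v) (hα' γ hγ)
    simp [pullback] at h1 ⊢
    exact Or.inl h1

/-- `Γ\ℝⁿ` is orientable: it carries a nowhere vanishing smooth real `n`-form. -/
def Orientable {n : ℕ} (Γ : Subgroup (Isom n)) : Prop :=
  ∃ α ∈ smoothForms ℝ Γ n, ∀ x, α x ≠ 0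

/-- The codifferential `δ α = - ∑ᵢ ι_{eᵢ} ∇_{eᵢ} α` from `(p+1)`-forms to `p`-forms, where `∇` is
the Levi-Civita connection of the flat metric. -/
def codifferential (α : Form 𝕜 n (p + 1)) : Form 𝕜 n p := fun x =>
  - ∑ i : Fin n, (fderiv ℝ α x (EuclideanSpace.single i 1)).curryLeft (EuclideanSpace.single i 1)

/-- The (non-negative) Hodge Laplacian `d δ + δ d` on `p`-forms; `δ = 0` on functions. -/
def hodgeLaplacian : {p : ℕ} → Form 𝕜 n p → Form 𝕜 n p
  | 0, α => codifferential (extDeriv α)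
  | _ + 1, α => extDeriv (codifferential α) + codifferential (extDeriv α)

/-! Linearity of these operators on smooth forms. -/

theorem contDiff_extDeriv {α : Form 𝕜 n p} (h : ContDiff ℝ ∞ α) : ContDiff ℝ ∞ (extDeriv α) :=
  (ContinuousAlternatingMap.alternatizeUncurryFinCLM ℝ (E n) 𝕜).contDiff.comp
    (h.fderiv_right (by simp))

theorem contDiff_codifferential {α : Form 𝕜 n (p + 1)} (h : ContDiff ℝ ∞ α) :
    ContDiff ℝ ∞ (codifferential α) := by
  refine (ContDiff.sum fun i _ => ?_).neg
  have h1 : ContDiff ℝ ∞ (fun x => fderiv ℝ α x (EuclideanSpace.single i 1)) :=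
    (h.fderiv_right (by simp)).clm_apply contDiff_const
  have h2 : ContDiff ℝ ∞ fun f : E n [⋀^Fin (p + 1)]→L[ℝ] 𝕜 => f.curryLeft :=
    ContinuousLinearMap.contDiff (𝕜 := ℝ) (E := E n [⋀^Fin (p + 1)]→L[ℝ] 𝕜)
      (F := E n →L[ℝ] E n [⋀^Fin p]→L[ℝ] 𝕜)
      (ContinuousAlternatingMap.curryLeftLI (𝕜 := ℝ) (E := E n) (F := 𝕜)
        (n := p)).toContinuousLinearMap
  exact (h2.comp h1).clm_apply contDiff_const

theorem extDeriv_add_smooth {α η : Form 𝕜 n p} (hα : ContDiff ℝ ∞ α) (hη : ContDiff ℝ ∞ η) :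
    extDeriv (α + η) = extDeriv α + extDeriv η :=
  funext fun x => extDeriv_add (hα.differentiable (by simp) x) (hη.differentiable (by simp) x)

theorem fderiv_smul_smooth {α : Form 𝕜 n p} (c : 𝕜) (hα : ContDiff ℝ ∞ α) (x : E n) :
    fderiv ℝ (c • α) x = c • fderiv ℝ α x :=
  fderiv_const_smul (hα.differentiable (by simp) x) c

theorem extDeriv_smul_smooth {α : Form 𝕜 n p} (c : 𝕜) (hα : ContDiff ℝ ∞ α) :
    extDeriv (c • α) = c • extDeriv α := by
  funext x
  simp only [extDeriv, fderiv_smul_smooth c hα, Pi.smul_apply]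
  exact ContinuousAlternatingMap.alternatizeUncurryFin_smul c _

theorem codifferential_add_smooth {α η : Form 𝕜 n (p + 1)} (hα : ContDiff ℝ ∞ α)
    (hη : ContDiff ℝ ∞ η) : codifferential (α + η) = codifferential α + codifferential η := by
  funext x
  ext v
  simp [codifferential, fderiv_add (hα.differentiable (by simp) x)
    (hη.differentiable (by simp) x), Finset.sum_add_distrib]
  ring

theorem codifferential_smul_smooth {α : Form 𝕜 n (p + 1)} (c : 𝕜) (hα : ContDiff ℝ ∞ α) :
    codifferential (c • α) = c • codifferential α := by
  funext x
  ext v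
  simp [codifferential, fderiv_smul_smooth c hα, Finset.mul_sum]

theorem hodgeLaplacian_add_smooth {α η : Form 𝕜 n p} (hα : ContDiff ℝ ∞ α)
    (hη : ContDiff ℝ ∞ η) : hodgeLaplacian (α + η) = hodgeLaplacian α + hodgeLaplacian η := by
  cases p with
  | zero =>
    simp only [hodgeLaplacian]
    rw [extDeriv_add_smooth hα hη,
      codifferential_add_smooth (contDiff_extDeriv hα) (contDiff_extDeriv hη)]
  | succ p =>
    simp only [hodgeLaplacian]
    rw [extDeriv_add_smooth hα hη,
      codifferential_add_smooth (contDiff_extDeriv hα) (contDiff_extDeriv hη),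
      codifferential_add_smooth hα hη,
      extDeriv_add_smooth (contDiff_codifferential hα) (contDiff_codifferential hη)]
    abel

theorem hodgeLaplacian_smul_smooth {α : Form 𝕜 n p} (c : 𝕜) (hα : ContDiff ℝ ∞ α) :
    hodgeLaplacian (c • α) = c • hodgeLaplacian α := by
  cases p with
  | zero =>
    simp only [hodgeLaplacian]
    rw [extDeriv_smul_smooth c hα, codifferential_smul_smooth c (contDiff_extDeriv hα)]
  | succ p =>
    simp only [hodgeLaplacian]
    rw [extDeriv_smul_smooth c hα, codifferential_smul_smooth c (contDiff_extDeriv hα),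
      codifferential_smul_smooth c hα, extDeriv_smul_smooth c (contDiff_codifferential hα),
      smul_add]

/-! ### Spectra and Betti numbers -/

/-- The space of smooth complex `p`-forms on `Γ\ℝⁿ` with `(dδ + δd) α = t α`. -/
def eigenspace {n : ℕ} (Γ : Subgroup (Isom n)) (p : ℕ) (t : ℝ) : Submodule ℂ (Form ℂ n p) where
  carrier := {α | α ∈ smoothForms ℂ Γ p ∧ hodgeLaplacian α = (t : ℂ) • α}
  zero_mem' := ⟨zero_mem _, by
    have h := hodgeLaplacian_smul_smooth (0 : ℂ) (α := (0 : Form ℂ n p)) contDiff_const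
    rw [smul_zero, zero_smul] at h
    rw [h, smul_zero]⟩
  add_mem' := by
    rintro α η ⟨hα, hα'⟩ ⟨hη, hη'⟩
    exact ⟨add_mem hα hη, by rw [hodgeLaplacian_add_smooth hα.1 hη.1, hα', hη', smul_add]⟩
  smul_mem' := by
    rintro c α ⟨hα, hα'⟩
    exact ⟨Submodule.smul_mem _ c hα, by
      rw [hodgeLaplacian_smul_smooth c hα.1, hα', smul_comm]⟩

/-- The multiplicity of `t` in `spec^p(Γ\ℝⁿ)` (zero if `t` is not an eigenvalue). -/
def multiplicity {n : ℕ} (Γ : Subgroup (Isom n)) (p : ℕ) (t : ℝ) : Cardinal :=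
  Module.rank ℂ (eigenspace Γ p t)

/-- `Γ\ℝⁿ` and `Γ'\ℝⁿ` are `p`-isospectral: the Hodge Laplacians on `p`-forms have the same
eigenvalues with the same multiplicities. -/
def PIsospectral {n : ℕ} (p : ℕ) (Γ Γ' : Subgroup (Isom n)) : Prop :=
  ∀ t : ℝ, multiplicity Γ p t = multiplicity Γ' p t

/-- `d_{p,μ}(Γ)`, the multiplicity of the eigenvalue `4π²μ` on `p`-forms. -/
def d {n : ℕ} (Γ : Subgroup (Isom n)) (p : ℕ) (μ : ℝ) : Cardinal :=
  multiplicity Γ p (4 * Real.pi ^ 2 * μ)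

/-- Closed `p`-forms on `Γ\ℝⁿ`. -/
def closedForms {n : ℕ} (Γ : Subgroup (Isom n)) (p : ℕ) : Submodule ℂ (Form ℂ n p) where
  carrier := {α | α ∈ smoothForms ℂ Γ p ∧ extDeriv α = 0}
  zero_mem' := ⟨zero_mem _, by
    have h := extDeriv_smul_smooth (0 : ℂ) (α := (0 : Form ℂ n p)) contDiff_const
    rwa [smul_zero, zero_smul] at h⟩
  add_mem' := by
    rintro α η ⟨hα, hα'⟩ ⟨hη, hη'⟩
    exact ⟨add_mem hα hη, by rw [extDeriv_add_smooth hα.1 hη.1, hα', hη', add_zero]⟩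
  smul_mem' := by
    rintro c α ⟨hα, hα'⟩
    exact ⟨Submodule.smul_mem _ c hα, by rw [extDeriv_smul_smooth c hα.1, hα', smul_zero]⟩

/-- The exterior derivative on smooth forms on `Γ\ℝⁿ`, as a linear map. -/
def dLinear {n : ℕ} (Γ : Subgroup (Isom n)) (p : ℕ) :
    smoothForms ℂ Γ p →ₗ[ℂ] Form ℂ n (p + 1) where
  toFun α := extDeriv α.1
  map_add' α η := extDeriv_add_smooth α.2.1 η.2.1
  map_smul' c α := extDeriv_smul_smooth c α.2.1

/-- Exact `p`-forms on `Γ\ℝⁿ`. -/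
def exactForms {n : ℕ} (Γ : Subgroup (Isom n)) : (p : ℕ) → Submodule ℂ (Form ℂ n p)
  | 0 => ⊥
  | p + 1 => LinearMap.range (dLinear Γ p)

/-- The `p`-th Betti number of `Γ\ℝⁿ`: the dimension of its de Rham cohomology (closed forms modulo
exact forms) in degree `p`, with complex coefficients. -/
def betti {n : ℕ} (Γ : Subgroup (Isom n)) (p : ℕ) : Cardinal :=
  Module.rank ℂ (closedForms Γ p ⧸ (exactForms Γ p).submoduleOf (closedForms Γ p))

/-! ### Krawtchouk polynomials -/

/-- The value `K_l^h(j) = ∑_{t=0}^{l} (-1)^t (j choose t) (h-j choose l-t)` of the binary Krawtchouk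
polynomial at an integer `0 ≤ j ≤ h`. -/
def krawtchouk (l h j : ℕ) : ℤ :=
  ∑ t ∈ Finset.range (l + 1), (-1) ^ t * (j.choose t : ℤ) * ((h - j).choose (l - t) : ℤ)

/-! ### The two groups -/

/-- The matrix `diag(1, …, 1, -1, …, -1)` of size 9 with `k` entries `1`. -/
def diagSign (k : ℕ) : E 9 ≃ₗᵢ[ℝ] E 9 :=
  LinearIsometryEquiv.piLpCongrRight 2 fun i : Fin 9 =>
    if (i : ℕ) < k then LinearIsometryEquiv.refl ℝ ℝ else LinearIsometryEquiv.neg ℝ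

/-- The group generated by `C L_{e₁/2}`, with `C = diag(1, …, 1, -1, …, -1)` (`k` entries `1`), and
the translations `L_λ` with `λ ∈ Λ`. -/
def diagGroup (k : ℕ) : Subgroup (Isom 9) :=
  Subgroup.closure
    ({(diagSign k).toAffineIsometryEquiv * translation (EuclideanSpace.single 0 (1 / 2))} ∪
      {γ | ∃ v ∈ canonicalLattice 9, γ = translation v})

/-- `Γ = ⟨B L_{e₁/2}, L_Λ⟩` with `B = diag(1,1,1,-1,-1,-1,-1,-1,-1)`. -/
def Γ₁ : Subgroup (Isom 9) := diagGroup 3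

/-- `Γ' = ⟨B' L_{e₁/2}, L_Λ⟩` with `B' = diag(1,1,1,1,1,1,-1,-1,-1)`. -/
def Γ₂ : Subgroup (Isom 9) := diagGroup 6

end FlatForms

end

/-! A form on the quotient is a smooth Λ-periodic form on ℝ⁹ that is invariant under the single
isometry `generator k`. Cartan's formula shows that in flat space dδ + δd acts on each coefficient
of dx_I as the scalar operator -∑ ∂ᵢ² (`hodgeLaplacian_eq`), and the linear part of the generator,
being diagonal, multiplies dx_I by a sign `formSign k I`. An eigenform is therefore an independent
choice, for each I, of a periodic scalar eigenfunction that the generator multiplies by that sign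
(`eigenspaceEquiv`). Writing N± for the number of p-element I with sign ±1, and h±(t) for the
dimensions of the even and odd scalar eigenspaces, the multiplicity of t is N₊h₊(t) + N₋h₋(t)
(`multiplicity_eq`).

The sum h₊ + h₋ is the dimension of the eigenspace of the torus, so it does not depend on the group.
If N₊ = N₋ for both groups, with the same value, then all multiplicities agree
(`pIsospectral_of_signCount`); this happens for p = 2, 7. Conceptually N₊ - N₋ is the trace of the
linear part on p-forms, that is K_p^9(j) with j the number of entries -1, so these degrees come from
zeros of Krawtchouk polynomials at j = 6 and j = 3. The proof does not use this identity: the counts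
are evaluated directly.

For the other p two eigenvalues suffice. At t = 0 one has h₊ = 1 and h₋ = 0, so the multiplicity is
N₊, which separates p = 1, 3, 5, 9. At t = 4π² the cosines and sines of the nine coordinates form a
basis of signed eigenfunctions, with (h₊, h₋) = (10, 8) and (13, 5), which separates p = 0, 4, 6, 8.

The analysis is elementary. Completeness of characters follows from one-variable Fourier uniqueness,
one coordinate at a time (`eq_zero_of_mean_chi_mul`). The Hodge theorem needed for Betti numbers
(`betti_eq`) comes from an explicit averaging homotopy: a closed periodic form differs from its mean
by an exact one (`torusExact_sub_meanValue`), and symmetrizing under the generator descends this to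
the quotient. The group-theoretic claims rest on the normal form `mem_diagGroup`. -/

namespace FlatForms

open scoped ContDiff Topology

/-! ### Averages of smooth functions along coordinate directions -/

section Averages

variable {F F' : Type} [NormedAddCommGroup F] [NormedSpace ℝ F]
  [NormedAddCommGroup F'] [NormedSpace ℝ F'] {n : ℕ}

/-- The `i`-th vector of the canonical basis of `ℝⁿ`. -/
noncomputable abbrev stdVec (i : Fin n) : E n := EuclideanSpace.single i (1 : ℝ)

/-- The weighted average `x ↦ ∫₀¹ w(s) f(x + s eᵢ) ds`. -/
noncomputable def avg (w : ℝ → ℝ) (i : Fin n) (f : E n → F) : E n → F := fun x =>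
  ∫ s in (0 : ℝ)..1, w s • f (x + s • stdVec i)

/-- The partial derivative in the direction of `eᵢ`. -/
noncomputable def partialD (i : Fin n) (f : E n → F) : E n → F := fun x => fderiv ℝ f x (stdVec i)

theorem hasFDerivAt_avg {w : ℝ → ℝ} (hw : Continuous w) (i : Fin n) {f : E n → F}
    (hf : ContDiff ℝ 1 f) (x : E n) : HasFDerivAt (avg w i f) (avg w i (fderiv ℝ f) x) x := by
  have hf' : Continuous (fderiv ℝ f) := hf.continuous_fderiv one_ne_zero
  have hcont : ∀ {G : Type} [NormedAddCommGroup G] [NormedSpace ℝ G] {g : E n → G},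
      Continuous g → Continuous fun q : E n × ℝ => w q.2 • g (q.1 + q.2 • stdVec i) := by
    intro G _ _ g hg
    fun_prop
  -- The dominating function is a constant: the derivative of the integrand is bounded on the
  -- compact set (unit ball around `x`) × [0,1].
  obtain ⟨C, hC⟩ := ((isCompact_closedBall x 1).prod (isCompact_Icc (a := (0 : ℝ))
    (b := 1))).exists_bound_of_continuousOn (hcont hf').continuousOn
  have hslice : ∀ {G : Type} [NormedAddCommGroup G] [NormedSpace ℝ G] {g : E n → G},
      Continuous g → ∀ y, Continuous fun s : ℝ => w s • g (y + s • stdVec i) :=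
    fun hg y => (hcont hg).comp (Continuous.prodMk_right y)
  refine intervalIntegral.hasFDerivAt_integral_of_dominated_of_fderiv_le
    (F' := fun y s => w s • fderiv ℝ f (y + s • stdVec i)) (bound := fun _ => C)
    (Metric.closedBall_mem_nhds x one_pos) (Filter.Eventually.of_forall fun y =>
      (hslice hf.continuous y).aestronglyMeasurable)
    ((hslice hf.continuous x).intervalIntegrable _ _) (hslice hf' x).aestronglyMeasurable
    (Filter.Eventually.of_forall fun s hs y hy => hC (y, s) ⟨hy, ?_⟩)
    intervalIntegrable_const (Filter.Eventually.of_forall fun s _ y _ => ?_)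
  · rw [Set.uIoc_of_le zero_le_one] at hs
    exact ⟨hs.1.le, hs.2⟩
  · have h1 := (hf.differentiable one_ne_zero (y + s • stdVec i)).hasFDerivAt
    exact (h1.comp y ((hasFDerivAt_id y).add_const (s • stdVec i))).const_smul (w s)

theorem fderiv_avg {w : ℝ → ℝ} (hw : Continuous w) (i : Fin n) {f : E n → F}
    (hf : ContDiff ℝ ∞ f) : fderiv ℝ (avg w i f) = avg w i (fderiv ℝ f) :=
  funext fun x => (hasFDerivAt_avg hw i (hf.of_le (by simp)) x).fderiv

theorem contDiff_avg {w : ℝ → ℝ} (hw : Continuous w) (i : Fin n) {f : E n → F}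
    (hf : ContDiff ℝ ∞ f) : ContDiff ℝ ∞ (avg w i f) := by
  -- The target space must vary in the induction, since the step passes from the function to its
  -- `fderiv`.
  have key : ∀ m : ℕ, ∀ {G : Type} [NormedAddCommGroup G] [NormedSpace ℝ G] {g : E n → G},
      ContDiff ℝ ∞ g → ContDiff ℝ m (avg w i g) := by
    intro m
    induction m with
    | zero =>
      intro G _ _ g hg
      rw [Nat.cast_zero, contDiff_zero]
      exact continuous_iff_continuousAt.2 fun x =>
        (hasFDerivAt_avg hw i (hg.of_le (by simp)) x).continuousAt
    | succ m ih =>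
      intro G _ _ g hg
      rw [Nat.cast_succ, contDiff_succ_iff_fderiv]
      refine ⟨fun x => (hasFDerivAt_avg hw i (hg.of_le (by simp)) x).differentiableAt,
        by simp, ?_⟩
      rw [fderiv_avg hw i hg]
      exact ih (hg.fderiv_right (by simp))
  exact contDiff_infty.2 fun m => key m hf

theorem continuous_slice {w : ℝ → ℝ} (hw : Continuous w) (i : Fin n) {f : E n → F}
    (hf : Continuous f) (x : E n) : Continuous fun s : ℝ => w s • f (x + s • stdVec i) := by
  fun_prop

theorem avg_clm [CompleteSpace F] [CompleteSpace F'] {w : ℝ → ℝ} (hw : Continuous w) (i : Fin n)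
    {f : E n → F} (hf : Continuous f) (L : F →L[ℝ] F') :
    avg w i (fun x => L (f x)) = fun x => L (avg w i f x) := by
  funext x
  rw [avg, avg, ← L.intervalIntegral_comp_comm ((continuous_slice hw i hf x).intervalIntegrable _ _)]
  simp

theorem contDiff_partialD (i : Fin n) {f : E n → F} (hf : ContDiff ℝ ∞ f) :
    ContDiff ℝ ∞ (partialD i f) :=
  (hf.fderiv_right (by simp)).clm_apply contDiff_const

theorem partialD_avg [CompleteSpace F] {w : ℝ → ℝ} (hw : Continuous w) (i j : Fin n) {f : E n → F}
    (hf : ContDiff ℝ ∞ f) : partialD j (avg w i f) = avg w i (partialD j f) := by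
  have h := avg_clm hw i (hf.continuous_fderiv (by simp))
    (ContinuousLinearMap.apply ℝ F (stdVec j : E n))
  funext x
  rw [partialD, fderiv_avg hw i hf]
  exact (congrFun h x).symm

/-- Functions on `ℝⁿ` that are periodic for the canonical lattice. -/
def Periodic (f : E n → F) : Prop := ∀ i x, f (x + stdVec i) = f x

theorem Periodic.avg {f : E n → F} (hf : Periodic f) (w : ℝ → ℝ) (i : Fin n) :
    Periodic (avg w i f) := by
  intro j x
  simp only [FlatForms.avg]
  congr 1
  funext s
  rw [add_right_comm, hf]

theorem Periodic.fderiv {f : E n → F} (hf : Periodic f) : Periodic (fderiv ℝ f) := by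
  intro i x
  rw [← fderiv_comp_add_right (f := f) (stdVec i)]
  congr 1
  exact funext (hf i)

theorem Periodic.partialD {f : E n → F} (hf : Periodic f) (i : Fin n) :
    Periodic (partialD i f) := fun j x => by
  rw [FlatForms.partialD, FlatForms.partialD, hf.fderiv]

theorem hasDerivAt_slice (i : Fin n) {f : E n → F} (hf : ContDiff ℝ ∞ f) (x : E n) (s : ℝ) :
    HasDerivAt (fun s : ℝ => f (x + s • stdVec i)) (partialD i f (x + s • stdVec i)) s := by
  have h1 := (hf.differentiable (by simp) (x + s • stdVec i)).hasFDerivAt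
  have h2 : HasDerivAt (fun s : ℝ => x + s • stdVec i) (stdVec i) s := by
    simpa using ((hasDerivAt_id s).smul_const (stdVec i)).const_add x
  exact h1.comp_hasDerivAt s h2

/-- Fundamental theorem of calculus; the two boundary terms cancel by periodicity. -/
theorem avg_one_partialD [CompleteSpace F] (i : Fin n) {f : E n → F} (hf : ContDiff ℝ ∞ f)
    (hp : Periodic f) : avg (fun _ => 1) i (partialD i f) = 0 := by
  funext x
  simp only [avg, one_smul]
  rw [intervalIntegral.integral_eq_sub_of_hasDerivAt (fun s _ => hasDerivAt_slice i hf x s)]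
  · simp [hp i x]
  · have := continuous_slice (w := fun _ => 1) continuous_const i (contDiff_partialD i hf).continuous x
    simpa using this.intervalIntegrable (μ := MeasureTheory.volume) 0 1

/-- Integration by parts against the weight s: the boundary term is f(x + eᵢ) = f(x). This makes
`avg id i` a primitive in direction i up to the average, hence a homotopy operator for forms. -/
theorem partialD_avg_id [CompleteSpace F] (i : Fin n) {f : E n → F} (hf : ContDiff ℝ ∞ f)
    (hp : Periodic f) : partialD i (avg id i f) = f - avg (fun _ => 1) i f := by
  rw [partialD_avg continuous_id i i hf]
  funext x
  have h1 := (continuous_slice (w := fun _ => 1) continuous_const i hf.continuous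
    x).intervalIntegrable (μ := MeasureTheory.volume) 0 1
  have h2 := (continuous_slice continuous_id i (contDiff_partialD i hf).continuous
    x).intervalIntegrable (μ := MeasureTheory.volume) 0 1
  have key := intervalIntegral.integral_eq_sub_of_hasDerivAt
    (fun s _ => (hasDerivAt_id s).smul (hasDerivAt_slice i hf x s)) (h2.add h1)
  rw [intervalIntegral.integral_add h2 h1] at key
  rw [Pi.sub_apply, avg, avg, eq_sub_iff_add_eq, key]
  simp [hp i x]

/-! ### Iterated averages and the mean over the torus. -/

/-- The iterated average over the coordinate directions in a list. -/
noncomputable def mean : List (Fin n) → (E n → F) → E n → F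
  | [], f => f
  | i :: l, f => mean l (avg (fun _ => 1) i f)

theorem contDiff_mean (l : List (Fin n)) {f : E n → F} (hf : ContDiff ℝ ∞ f) :
    ContDiff ℝ ∞ (mean l f) := by
  induction l generalizing f with
  | nil => exact hf
  | cons i l ih => exact ih (contDiff_avg continuous_const i hf)

theorem partialD_mean [CompleteSpace F] (l : List (Fin n)) (j : Fin n) {f : E n → F}
    (hf : ContDiff ℝ ∞ f) : partialD j (mean l f) = mean l (partialD j f) := by
  induction l generalizing f with
  | nil => rfl
  | cons i l ih =>
    rw [mean, ih (contDiff_avg continuous_const i hf), partialD_avg continuous_const i j hf, mean]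

theorem avg_zero (w : ℝ → ℝ) (i : Fin n) : avg w i (0 : E n → F) = 0 := by
  funext x
  simp [avg]

theorem mean_zero (l : List (Fin n)) : mean l (0 : E n → F) = 0 := by
  induction l with
  | nil => rfl
  | cons i l ih => rw [mean, avg_zero, ih]

theorem avg_add (i : Fin n) {f g : E n → F} (hf : Continuous f) (hg : Continuous g) :
    avg (fun _ => 1) i (f + g) = avg (fun _ => 1) i f + avg (fun _ => 1) i g := by
  funext x
  simp only [avg, Pi.add_apply, smul_add]
  exact intervalIntegral.integral_add
    ((continuous_slice continuous_const i hf x).intervalIntegrable _ _)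
    ((continuous_slice continuous_const i hg x).intervalIntegrable _ _)

theorem mean_add (l : List (Fin n)) {f g : E n → F} (hf : ContDiff ℝ ∞ f) (hg : ContDiff ℝ ∞ g) :
    mean l (f + g) = mean l f + mean l g := by
  induction l generalizing f g with
  | nil => rfl
  | cons i l ih =>
    rw [mean, avg_add i hf.continuous hg.continuous,
      ih (contDiff_avg continuous_const i hf) (contDiff_avg continuous_const i hg), mean, mean]

theorem mean_clm [CompleteSpace F] [CompleteSpace F'] (l : List (Fin n)) {f : E n → F}
    (hf : ContDiff ℝ ∞ f) (L : F →L[ℝ] F') :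
    mean l (fun x => L (f x)) = fun x => L (mean l f x) := by
  induction l generalizing f with
  | nil => rfl
  | cons i l ih =>
    rw [mean, avg_clm continuous_const i hf.continuous, ih (contDiff_avg continuous_const i hf), mean]

theorem mean_const [CompleteSpace F] (l : List (Fin n)) (c : F) :
    mean l (fun _ : E n => c) = fun _ => c := by
  induction l with
  | nil => rfl
  | cons i l ih =>
    have : avg (fun _ => 1) i (fun _ : E n => c) = fun _ => c := by
      funext x
      simp [avg]
    rw [mean, this, ih]

/-- The derivative commutes with every average until direction `i` itself is averaged, where it
integrates to zero. -/
theorem mean_partialD [CompleteSpace F] {l : List (Fin n)} {i : Fin n} (hi : i ∈ l) {f : E n → F}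
    (hf : ContDiff ℝ ∞ f) (hp : Periodic f) : mean l (partialD i f) = 0 := by
  induction l generalizing f with
  | nil => simp at hi
  | cons j l ih =>
    by_cases hij : i = j
    · subst hij
      rw [mean, avg_one_partialD i hf hp, mean_zero]
    · rw [mean, ← partialD_avg continuous_const j i hf]
      exact ih (List.mem_of_ne_of_mem hij hi) (contDiff_avg continuous_const j hf) (hp.avg _ j)

theorem fderiv_eq_zero_of_partialD {f : E n → F} (h : ∀ i, partialD i f = 0) : fderiv ℝ f = 0 := by
  funext x
  have : (fderiv ℝ f x : E n →ₗ[ℝ] F) = 0 :=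
    (EuclideanSpace.basisFun (Fin n) ℝ).toBasis.ext fun i => by
      simpa [partialD] using congrFun (h i) x
  ext v
  exact LinearMap.congr_fun this v

/-- The mean value of a periodic function. -/
noncomputable def meanValue (f : E n → F) : F := mean (List.finRange n) f 0

theorem mean_finRange [CompleteSpace F] {f : E n → F} (hf : ContDiff ℝ ∞ f) (hp : Periodic f) :
    mean (List.finRange n) f = fun _ => meanValue f := by
  funext x
  have hd : fderiv ℝ (mean (List.finRange n) f) = 0 := fderiv_eq_zero_of_partialD fun i => by
    rw [partialD_mean _ _ hf, mean_partialD (List.mem_finRange i) hf hp]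
  exact is_const_of_fderiv_eq_zero ((contDiff_mean _ hf).differentiable (by simp))
    (fun y => congrFun hd y) x 0

theorem meanValue_partialD [CompleteSpace F] (i : Fin n) {f : E n → F}
    (hf : ContDiff ℝ ∞ f) (hp : Periodic f) : meanValue (partialD i f) = 0 :=
  congrFun (mean_partialD (List.mem_finRange i) hf hp) 0

theorem meanValue_clm [CompleteSpace F] [CompleteSpace F'] {f : E n → F}
    (hf : ContDiff ℝ ∞ f) (L : F →L[ℝ] F') : meanValue (fun x => L (f x)) = L (meanValue f) :=
  congrFun (mean_clm _ hf L) 0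

theorem meanValue_add {f g : E n → F} (hf : ContDiff ℝ ∞ f) (hg : ContDiff ℝ ∞ g) :
    meanValue (f + g) = meanValue f + meanValue g :=
  congrFun (mean_add _ hf hg) 0

theorem meanValue_zero : meanValue (0 : E n → F) = 0 :=
  congrFun (mean_zero _) 0

theorem meanValue_const [CompleteSpace F] (c : F) : meanValue (fun _ : E n => c) = c :=
  congrFun (mean_const _ c) 0

end Averages

end FlatForms

namespace FlatForms

open scoped ContDiff Topology

/-! ### Fourier coefficients of periodic functions on `ℝⁿ` -/

section Fourier

variable {n : ℕ}

/-- A continuous function of period one all of whose Fourier coefficients vanish is zero. -/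
theorem eq_zero_of_fourier_integral_eq_zero {g : ℝ → ℂ} (hg : Continuous g)
    (hp : Function.Periodic g 1)
    (h : ∀ m : ℤ, ∫ s in (0 : ℝ)..1, Complex.exp (2 * Real.pi * Complex.I * (-m : ℤ) * s) * g s = 0) :
    g = 0 := by
  have : Fact ((0 : ℝ) < 1) := ⟨one_pos⟩
  let f : C(AddCircle (1 : ℝ), ℂ) := ⟨hp.lift, continuous_coinduced_dom.2 hg⟩
  have hc : fourierCoeff f = 0 := by
    funext m
    rw [fourierCoeff_eq_intervalIntegral _ _ 0]
    have := h m
    simp only [fourier_coe_apply, zero_add, one_smul, smul_eq_mul,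
      Complex.ofReal_one, div_one, Pi.zero_apply]
    exact this
  funext s
  -- Vanishing coefficients are summable, so the Fourier series converges pointwise to the function;
  -- its sum is zero.
  have h1 := has_pointwise_sum_fourier_series_of_summable (f := f)
    (by rw [hc]; exact summable_zero) (s : AddCircle (1 : ℝ))
  rw [hc] at h1
  simp only [Pi.zero_apply, zero_smul] at h1
  exact h1.unique hasSum_zero

/-! ### Characters and Fourier coefficients of the torus. -/

/-- The character `x ↦ exp(2πi a·x)` of `ℝⁿ/ℤⁿ`. -/
noncomputable def chi (a : Fin n → ℤ) (x : E n) : ℂ :=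
  Complex.exp (2 * Real.pi * Complex.I * ∑ i, (a i : ℂ) * (x i : ℂ))

theorem chi_add (a b : Fin n → ℤ) (x : E n) : chi (a + b) x = chi a x * chi b x := by
  simp only [chi, ← Complex.exp_add, Pi.add_apply, Int.cast_add, add_mul, Finset.sum_add_distrib,
    mul_add]

theorem chi_zero (x : E n) : chi 0 x = 1 := by simp [chi]

theorem chi_neg_mul_chi (a : Fin n → ℤ) (x : E n) : chi (-a) x * chi a x = 1 := by
  rw [← chi_add, neg_add_cancel, chi_zero]

theorem chi_add_smul (a : Fin n → ℤ) (x : E n) (s : ℝ) (i : Fin n) :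
    chi a (x + s • stdVec i) = chi a x * Complex.exp (2 * Real.pi * Complex.I * a i * s) := by
  rw [chi, chi, ← Complex.exp_add]
  congr 1
  have : ∀ j, (a j : ℂ) * ((x + s • stdVec i : E n) j : ℂ)
      = a j * x j + if j = i then (a i * s : ℂ) else 0 := by
    intro j
    by_cases hj : j = i
    · subst hj; simp [mul_add]
    · simp [hj]
  simp only [this, Finset.sum_add_distrib, Finset.sum_ite_eq', Finset.mem_univ, if_true]
  ring

theorem contDiff_chi (a : Fin n → ℤ) : ContDiff ℝ ∞ (chi a) := by
  have h1 : ∀ i, ContDiff ℝ ∞ fun x : E n => ((x i : ℝ) : ℂ) := fun i =>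
    Complex.ofRealCLM.contDiff.comp (contDiff_euclidean.1 contDiff_id i)
  have h2 : ContDiff ℝ ∞ fun z : ℂ => Complex.exp z :=
    (Complex.contDiff_exp (𝕜 := ℂ)).restrict_scalars ℝ
  exact h2.comp (contDiff_const.mul (ContDiff.sum fun i _ => contDiff_const.mul (h1 i)))

theorem periodic_chi (a : Fin n → ℤ) : Periodic (chi a) := by
  intro i x
  have h := chi_add_smul a x 1 i
  rw [one_smul] at h
  rw [h, Complex.ofReal_one, mul_one, mul_comm _ (a i : ℂ), Complex.exp_int_mul_two_pi_mul_I,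
    mul_one]

theorem partialD_chi (a : Fin n → ℤ) (i : Fin n) :
    partialD i (chi a) = fun x => (2 * Real.pi * Complex.I * a i) * chi a x := by
  funext x
  have h1 := hasDerivAt_slice i (contDiff_chi a) x 0
  have h2 : HasDerivAt (fun s : ℝ => chi a (x + s • stdVec i))
      (2 * Real.pi * Complex.I * a i * chi a x) 0 := by
    simp only [chi_add_smul]
    have h3 := ((((hasDerivAt_id (0 : ℝ)).ofReal_comp).const_mul
      (2 * Real.pi * Complex.I * a i : ℂ)).cexp).const_mul (chi a x)
    simp only [id_eq, Complex.ofReal_zero, mul_zero, Complex.exp_zero, Complex.ofReal_one,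
      mul_one, one_mul] at h3
    rwa [mul_comm (chi a x)] at h3
  rw [zero_smul, add_zero] at h1
  exact h1.unique h2

theorem partialD_mul (i : Fin n) {f g : E n → ℂ} (hf : ContDiff ℝ ∞ f) (hg : ContDiff ℝ ∞ g) :
    partialD i (f * g) = partialD i f * g + f * partialD i g := by
  funext x
  have := ((hf.differentiable (by simp) x).hasFDerivAt.mul
    (hg.differentiable (by simp) x).hasFDerivAt).fderiv
  simp only [partialD, Pi.add_apply, Pi.mul_apply, this]
  simp
  ring

theorem contDiff_chi_mul (a : Fin n → ℤ) {f : E n → ℂ} (hf : ContDiff ℝ ∞ f) :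
    ContDiff ℝ ∞ (chi a * f) :=
  (contDiff_chi a).mul hf

theorem contDiff_sum_pi {F : Type} [NormedAddCommGroup F] [NormedSpace ℝ F] {ι : Type}
    (s : Finset ι) {f : ι → E n → F} (hf : ∀ i, ContDiff ℝ ∞ (f i)) :
    ContDiff ℝ ∞ (∑ i ∈ s, f i) := by
  have : ContDiff ℝ ∞ fun x => ∑ i ∈ s, f i x := ContDiff.sum fun i _ => hf i
  convert this using 1
  funext x
  simp

theorem Periodic.mul {f g : E n → ℂ} (hf : Periodic f) (hg : Periodic g) : Periodic (f * g) :=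
  fun i x => by simp [hf i x, hg i x]

/-- The Fourier coefficient `∫ exp(-2πi a·x) f(x) dx`. -/
noncomputable def coeff (a : Fin n → ℤ) (f : E n → ℂ) : ℂ := meanValue (chi (-a) * f)

theorem meanValue_const_mul (c : ℂ) {f : E n → ℂ} (hf : ContDiff ℝ ∞ f) :
    meanValue (fun x => c * f x) = c * meanValue f :=
  meanValue_clm hf (ContinuousLinearMap.mul ℝ ℂ c)

theorem coeff_add (a : Fin n → ℤ) {f g : E n → ℂ} (hf : ContDiff ℝ ∞ f) (hg : ContDiff ℝ ∞ g) :
    coeff a (f + g) = coeff a f + coeff a g := by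
  rw [coeff, mul_add, meanValue_add (contDiff_chi_mul _ hf) (contDiff_chi_mul _ hg)]
  rfl

theorem coeff_const_mul (a : Fin n → ℤ) (c : ℂ) {f : E n → ℂ} (hf : ContDiff ℝ ∞ f) :
    coeff a (fun x => c * f x) = c * coeff a f := by
  rw [coeff, coeff, ← meanValue_const_mul c (contDiff_chi_mul (-a) hf)]
  congr 1
  funext x
  simp only [Pi.mul_apply]
  ring

theorem coeff_zero (a : Fin n → ℤ) : coeff a (0 : E n → ℂ) = 0 := by
  rw [coeff, mul_zero, meanValue_zero]

theorem coeff_sum (a : Fin n → ℤ) {ι : Type} (s : Finset ι) {f : ι → E n → ℂ}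
    (hf : ∀ i, ContDiff ℝ ∞ (f i)) : coeff a (∑ i ∈ s, f i) = ∑ i ∈ s, coeff a (f i) := by
  classical
  induction s using Finset.induction_on with
  | empty => simp [coeff_zero]
  | insert i s hi ih =>
    rw [Finset.sum_insert hi, Finset.sum_insert hi, coeff_add a (hf i) (contDiff_sum_pi s hf), ih]

/-- The derivative of `chi (-a) * f` has mean zero; Leibniz's rule turns this into the claim. -/
theorem coeff_partialD (a : Fin n → ℤ) (i : Fin n) {f : E n → ℂ} (hf : ContDiff ℝ ∞ f)
    (hp : Periodic f) : coeff a (partialD i f) = 2 * Real.pi * Complex.I * a i * coeff a f := by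
  have h1 := meanValue_partialD i (contDiff_chi_mul (-a) hf) ((periodic_chi (-a)).mul hp)
  have h2 : partialD i (chi (-a) * f) = (fun x => (-(2 * Real.pi * Complex.I * a i)) *
      (chi (-a) * f) x) + chi (-a) * partialD i f := by
    rw [partialD_mul i (contDiff_chi _) hf, partialD_chi]
    funext x
    simp
    ring
  have h3 := contDiff_chi_mul (-a) hf
  rw [h2,
    meanValue_add (contDiff_const.mul h3) (contDiff_chi_mul (-a) (contDiff_partialD i hf)),
    meanValue_const_mul _ h3] at h1
  rw [coeff, coeff]
  linear_combination h1

theorem coeff_chi (a b : Fin n → ℤ) : coeff a (chi b) = if a = b then 1 else 0 := by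
  split_ifs with h
  · subst h
    have : chi (-a) * chi a = fun _ : E n => (1 : ℂ) := funext (chi_neg_mul_chi a)
    rw [coeff, this, meanValue_const]
  -- Orthogonality without integrating: computing the coefficient of ∂ᵢ of the character in two ways
  -- gives the factors `a i` and `b i`, which differ.
  · obtain ⟨i, hi⟩ := Function.ne_iff.1 h
    have h1 := coeff_partialD a i (contDiff_chi b) (periodic_chi b)
    rw [partialD_chi, coeff_const_mul _ _ (contDiff_chi b), ← sub_eq_zero, ← sub_mul,
      ← mul_sub] at h1
    refine (mul_eq_zero.1 h1).resolve_left (mul_ne_zero Complex.two_pi_I_ne_zero ?_)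
    rw [sub_ne_zero]
    exact_mod_cast Ne.symm hi

theorem avg_chi_mul (i : Fin n) {a : Fin n → ℤ} (ha : a i = 0) (f : E n → ℂ) :
    avg (fun _ => 1) i (chi a * f) = chi a * avg (fun _ => 1) i f := by
  funext x
  simp only [avg, Pi.mul_apply, chi_add_smul, ha]
  simp

theorem eq_zero_of_avg_chi_mul (i : Fin n) {f : E n → ℂ} (hf : ContDiff ℝ ∞ f) (hp : Periodic f)
    (h : ∀ m : ℤ, avg (fun _ => 1) i (chi (Pi.single i (-m)) * f) = 0) : f = 0 := by
  funext x
  have key : (fun s : ℝ => f (x + s • stdVec i)) = 0 := by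
    refine eq_zero_of_fourier_integral_eq_zero ?_ ?_ fun m => ?_
    · exact hf.continuous.comp (by fun_prop)
    · intro s
      simp only [add_smul, one_smul, ← add_assoc]
      exact hp i _
    · have h1 := congrFun (h m) x
      simp only [avg, Pi.mul_apply, chi_add_smul, Pi.single_eq_same, one_smul, mul_assoc,
        Pi.zero_apply] at h1
      rw [intervalIntegral.integral_const_mul] at h1
      simp only [mul_assoc]
      exact (mul_eq_zero.1 h1).resolve_left (Complex.exp_ne_zero _)
  simpa using congrFun key 0

/-- Induction on the averaged coordinates, removing one by one-variable Fourier uniqueness.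
Frequencies are supported on `l` so that the remaining character is constant in the direction just
split off and can be pulled out of its average. -/
theorem eq_zero_of_mean_chi_mul (l : List (Fin n)) (hl : l.Nodup) {f : E n → ℂ}
    (hf : ContDiff ℝ ∞ f) (hp : Periodic f)
    (h : ∀ a : Fin n → ℤ, (∀ j ∉ l, a j = 0) → mean l (chi a * f) = 0) : f = 0 := by
  induction l generalizing f with
  | nil =>
    have := h 0 (fun _ _ => rfl)
    rw [mean] at this
    funext x
    simpa [chi_zero] using congrFun this x
  | cons i l ih =>
    rw [List.nodup_cons] at hl
    refine eq_zero_of_avg_chi_mul i hf hp fun m => ?_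
    refine ih hl.2 (contDiff_avg continuous_const i (contDiff_chi_mul _ hf))
      (((periodic_chi _).mul hp).avg _ i) fun a ha => ?_
    have h1 := h (a + Pi.single i (-m)) fun j hj => by
      rw [List.mem_cons, not_or] at hj
      simp [ha j hj.2, hj.1]
    have h2 : chi (a + Pi.single i (-m)) * f = chi a * (chi (Pi.single i (-m)) * f) := by
      funext x
      simp only [Pi.mul_apply, chi_add, mul_assoc]
    rwa [h2, mean, avg_chi_mul i (ha i hl.1)] at h1

theorem eq_zero_of_coeff_eq_zero {f : E n → ℂ} (hf : ContDiff ℝ ∞ f) (hp : Periodic f)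
    (h : ∀ a, coeff a f = 0) : f = 0 := by
  refine eq_zero_of_mean_chi_mul _ (List.nodup_finRange n) hf hp fun a _ => ?_
  rw [mean_finRange (contDiff_chi_mul a hf) ((periodic_chi a).mul hp)]
  funext x
  have := h (-a)
  rwa [coeff, neg_neg] at this

/-- The Laplacian `-∑ᵢ ∂ᵢ²`. -/
noncomputable def laplacian {F : Type} [NormedAddCommGroup F] [NormedSpace ℝ F] (f : E n → F) :
    E n → F := fun x => -∑ i, partialD i (partialD i f) x

theorem coeff_laplacian (a : Fin n → ℤ) {f : E n → ℂ} (hf : ContDiff ℝ ∞ f) (hp : Periodic f) :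
    coeff a (laplacian f) = 4 * Real.pi ^ 2 * (∑ i, (a i : ℂ) ^ 2) * coeff a f := by
  have h1 : laplacian f = fun x => (-1 : ℂ) * (∑ i, partialD i (partialD i f)) x := by
    funext x
    simp [laplacian]
  have h2 : ∀ i, ContDiff ℝ ∞ (partialD i (partialD i f)) := fun i =>
    contDiff_partialD i (contDiff_partialD i hf)
  have h3 := contDiff_sum_pi Finset.univ h2
  rw [h1, coeff_const_mul _ _ h3, coeff_sum _ _ h2, Finset.mul_sum, Finset.mul_sum,
    Finset.sum_mul]
  refine Finset.sum_congr rfl fun i _ => ?_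
  rw [coeff_partialD a i (contDiff_partialD i hf) (hp.partialD i), coeff_partialD a i hf hp]
  linear_combination (-4 * Real.pi ^ 2 * a i ^ 2 * coeff a f : ℂ) * Complex.I_sq

/-- A smooth periodic eigenfunction of the Laplacian is a combination of characters. -/
theorem eq_sum_chi_of_laplacian {f : E n → ℂ} (hf : ContDiff ℝ ∞ f) (hp : Periodic f) {t : ℝ}
    (h : laplacian f = (t : ℂ) • f) (S : Finset (Fin n → ℤ))
    (hS : ∀ a : Fin n → ℤ, 4 * Real.pi ^ 2 * (∑ i, (a i : ℝ) ^ 2) = t → a ∈ S) :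
    f = ∑ a ∈ S, coeff a f • chi a := by
  -- The Laplacian multiplies the coefficient at `a` by 4π²|a|², so a coefficient survives only
  -- where this equals `t`.
  have hc : ∀ a, a ∉ S → coeff a f = 0 := by
    intro a ha
    have h1 := coeff_laplacian a hf hp
    rw [h, show (t : ℂ) • f = fun x => (t : ℂ) * f x from rfl, coeff_const_mul _ _ hf,
      ← sub_eq_zero, ← sub_mul] at h1
    refine (mul_eq_zero.1 h1).resolve_left fun h2 => ha (hS a ?_)
    rw [sub_eq_zero] at h2
    exact_mod_cast h2.symm
  have hs : ∀ a, ContDiff ℝ ∞ (coeff a f • chi a) := fun a =>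
    contDiff_const.mul (contDiff_chi a)
  have hs' := contDiff_sum_pi S hs
  have hs'' : ContDiff ℝ ∞ ((-1 : ℂ) • ∑ a ∈ S, coeff a f • chi a) := contDiff_const.mul hs'
  have key : f + (-1 : ℂ) • (∑ a ∈ S, coeff a f • chi a) = 0 := by
    refine eq_zero_of_coeff_eq_zero (hf.add hs'') (fun i x => ?_) fun b => ?_
    · simp only [Pi.add_apply, Pi.smul_apply, Finset.sum_apply, hp i x, periodic_chi _ i x]
    · rw [coeff_add _ hf hs'',
        show (-1 : ℂ) • (∑ a ∈ S, coeff a f • chi a) =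
          fun x => (-1 : ℂ) * (∑ a ∈ S, coeff a f • chi a) x from rfl,
        coeff_const_mul _ _ hs', coeff_sum _ _ hs]
      have : ∀ a ∈ S, coeff b (coeff a f • chi a) = if b = a then coeff a f else 0 := by
        intro a _
        rw [show coeff a f • chi a = fun x => coeff a f * chi a x from rfl,
          coeff_const_mul _ _ (contDiff_chi a), coeff_chi]
        simp
      rw [Finset.sum_congr rfl this, Finset.sum_ite_eq]
      split_ifs with hb
      · ring
      · rw [hc b hb]; ring
  rw [neg_one_smul, ← sub_eq_add_neg, sub_eq_zero] at key
  exact key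

end Fourier

end FlatForms

namespace FlatForms

open scoped ContDiff Topology

/-! ### The Hodge Laplacian and the de Rham homotopy on periodic forms -/

section Forms

variable {n p : ℕ}

/-- The space of alternating `p`-linear forms on `ℝⁿ` with complex values. -/
abbrev Alt (n p : ℕ) : Type := E n [⋀^Fin p]→L[ℝ] ℂ

/-- The interior product with a vector. -/
noncomputable def interior (e : E n) : Alt n (p + 1) →L[ℝ] Alt n p :=
  (ContinuousLinearMap.apply ℝ (Alt n p) e).comp
    (ContinuousAlternatingMap.curryLeftLI (𝕜 := ℝ) (E := E n) (F := ℂ)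
      (n := p)).toContinuousLinearMap

theorem interior_apply (e : E n) (η : Alt n (p + 1)) (v : Fin p → E n) :
    interior e η v = η (Matrix.vecCons e v) := rfl

/-- The algebraic form of Cartan's formula. -/
theorem interior_alternatizeUncurryFin (e : E n) (f : E n →L[ℝ] Alt n (p + 1)) :
    interior e (ContinuousAlternatingMap.alternatizeUncurryFin f) +
      ContinuousAlternatingMap.alternatizeUncurryFin ((interior e).comp f) = f e := by
  ext w
  rw [ContinuousAlternatingMap.add_apply, interior_apply,
    ContinuousAlternatingMap.alternatizeUncurryFin_apply,
    ContinuousAlternatingMap.alternatizeUncurryFin_apply, Fin.sum_univ_succ]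
  simp only [Fin.val_zero, pow_zero, one_smul, Matrix.cons_val_zero, Matrix.cons_val_succ,
    Fin.val_succ, pow_succ, mul_neg, mul_one, neg_smul, Finset.sum_neg_distrib]
  have h0 : Fin.removeNth 0 (Matrix.vecCons e w) = w := by
    funext j
    simp [Fin.removeNth]
  -- Slot 0 of the alternating sum contributes `f e`. Every later slot keeps `e` in front and has
  -- its sign shifted by one, so it cancels a term of the second alternatization.
  have h1 : ∀ j : Fin (p + 1), Fin.removeNth j.succ (Matrix.vecCons e w) =
      Matrix.vecCons e (Fin.removeNth j w) := by
    intro j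
    funext k
    refine Fin.cases ?_ (fun k => ?_) k <;> simp [Fin.removeNth]
  rw [h0]
  simp only [h1]
  rw [add_assoc, add_eq_left, neg_add_eq_zero]
  rfl

theorem interior_alternatizeUncurryFin_zero (e : E n) (f : E n →L[ℝ] Alt n 0) :
    interior e (ContinuousAlternatingMap.alternatizeUncurryFin f) = f e := by
  ext w
  rw [interior_apply, ContinuousAlternatingMap.alternatizeUncurryFin_apply, Fin.sum_univ_one]
  simp only [Fin.val_zero, pow_zero, one_smul, Matrix.cons_val_zero]
  congr 1

theorem fderiv_interior (e : E n) {α : Form ℂ n (p + 1)} (hα : ContDiff ℝ ∞ α) (x : E n) :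
    fderiv ℝ (fun x => interior e (α x)) x = (interior e).comp (fderiv ℝ α x) :=
  ((interior e).hasFDerivAt.comp x (hα.differentiable (by simp) x).hasFDerivAt).fderiv

theorem contDiff_interior (e : E n) {α : Form ℂ n (p + 1)} (hα : ContDiff ℝ ∞ α) :
    ContDiff ℝ ∞ fun x => interior e (α x) :=
  (interior e).contDiff.comp hα

/-- Cartan's formula for a constant vector field. -/
theorem cartan (i : Fin n) {α : Form ℂ n (p + 1)} (hα : ContDiff ℝ ∞ α) (x : E n) :
    interior (stdVec i) (extDeriv α x) + extDeriv (fun x => interior (stdVec i) (α x)) x =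
      partialD i α x := by
  rw [extDeriv, extDeriv, fderiv_interior _ hα]
  exact interior_alternatizeUncurryFin _ _

/-- Symmetry of the second derivative. -/
theorem partialD_extDeriv (i : Fin n) {α : Form ℂ n p} (hα : ContDiff ℝ ∞ α) :
    partialD i (extDeriv α) = extDeriv (partialD i α) := by
  funext x
  have h1 : ContDiff ℝ ∞ (fderiv ℝ α) := hα.fderiv_right (by simp)
  have h2 := (h1.differentiable (by simp) x).hasFDerivAt
  have h3 : fderiv ℝ (extDeriv α) x =
      (ContinuousAlternatingMap.alternatizeUncurryFinCLM ℝ (E n) ℂ).comp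
        (fderiv ℝ (fderiv ℝ α) x) :=
    ((ContinuousAlternatingMap.alternatizeUncurryFinCLM ℝ (E n) ℂ).hasFDerivAt.comp x h2).fderiv
  have h4 : fderiv ℝ (partialD i α) x = fderiv ℝ (fderiv ℝ α) x (stdVec i) := by
    have h5 := ((ContinuousLinearMap.apply ℝ (Alt n p) (stdVec i : E n)).hasFDerivAt.comp x
      h2).fderiv
    have h6 : IsSymmSndFDerivAt ℝ α x :=
      hα.contDiffAt.isSymmSndFDerivAt (by
        rw [minSmoothness_of_isRCLikeNormedField]
        exact WithTop.coe_le_coe.2 (le_top : (2 : ℕ∞) ≤ ⊤))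
    ext v : 1
    refine (congrArg (fun T => T v) h5).trans ?_
    exact h6.eq v (stdVec i)
  rw [partialD, h3, extDeriv, h4]
  rfl

theorem codifferential_eq (α : Form ℂ n (p + 1)) :
    codifferential α = fun x => -∑ i, interior (stdVec i) (partialD i α x) := rfl

theorem extDeriv_sum {ι : Type} (s : Finset ι) {f : ι → Form ℂ n p}
    (hf : ∀ i, ContDiff ℝ ∞ (f i)) : extDeriv (∑ i ∈ s, f i) = ∑ i ∈ s, extDeriv (f i) := by
  classical
  induction s using Finset.induction_on with
  | empty =>
    have h := extDeriv_smul_smooth (0 : ℂ) (α := (0 : Form ℂ n p)) contDiff_const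
    rwa [smul_zero, zero_smul] at h
  | insert i s hi ih =>
    rw [Finset.sum_insert hi, Finset.sum_insert hi,
      extDeriv_add_smooth (hf i) (contDiff_sum_pi s hf), ih]

/-- The Weitzenböck formula in flat space: the Hodge Laplacian is `-∑ᵢ ∂ᵢ²`. -/
theorem hodgeLaplacian_eq {α : Form ℂ n p} (hα : ContDiff ℝ ∞ α) :
    hodgeLaplacian α = laplacian α := by
  cases p with
  | zero =>
    funext x
    rw [hodgeLaplacian, codifferential_eq, laplacian]
    refine congrArg Neg.neg (Finset.sum_congr rfl fun i _ => ?_)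
    rw [partialD_extDeriv i hα, extDeriv]
    exact interior_alternatizeUncurryFin_zero _ _
  | succ p =>
    have h1 : ∀ i, ContDiff ℝ ∞ fun x => interior (stdVec i) (partialD i α x) := fun i =>
      contDiff_interior _ (contDiff_partialD i hα)
    have h2 : codifferential α =
        (-1 : ℂ) • ∑ i, (fun x => interior (stdVec i) (partialD i α x)) := by
      rw [codifferential_eq]
      funext x
      rw [Pi.smul_apply, Finset.sum_apply]
      exact (neg_one_smul ℂ _).symm
    funext x
    rw [hodgeLaplacian, Pi.add_apply, h2,
      extDeriv_smul_smooth (-1 : ℂ) (contDiff_sum_pi _ h1), extDeriv_sum _ h1, codifferential_eq,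
      laplacian, Pi.smul_apply, Finset.sum_apply, neg_one_smul, ← neg_add,
      ← Finset.sum_add_distrib]
    -- Summand by summand, dδ + δd is Cartan's formula applied to ∂ᵢα, which yields ∂ᵢ∂ᵢα.
    refine congrArg Neg.neg (Finset.sum_congr rfl fun i _ => ?_)
    rw [partialD_extDeriv i hα, ← cartan i (contDiff_partialD i hα) x]
    exact add_comm _ _

/-! ### Exactness of periodic forms and the averaging homotopy. -/

theorem extDeriv_avg {w : ℝ → ℝ} (hw : Continuous w) (i : Fin n) {α : Form ℂ n p}
    (hα : ContDiff ℝ ∞ α) : extDeriv (avg w i α) = avg w i (extDeriv α) := by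
  have h := avg_clm hw i (hα.continuous_fderiv (by simp))
    (ContinuousAlternatingMap.alternatizeUncurryFinCLM ℝ (E n) ℂ (n := p))
  refine Eq.trans (funext fun x => ?_) h.symm
  rw [extDeriv, fderiv_avg hw i hα]
  rfl

/-- Exactness of a periodic form in the complex of smooth periodic forms. -/
def TorusExact : {p : ℕ} → Form ℂ n p → Prop
  | 0, α => α = 0
  | _ + 1, α => ∃ β, ContDiff ℝ ∞ β ∧ Periodic β ∧ extDeriv β = α

theorem TorusExact.add {α η : Form ℂ n p} (hα : TorusExact α) (hη : TorusExact η) :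
    TorusExact (α + η) := by
  cases p with
  | zero =>
    rw [TorusExact] at *
    rw [hα, hη, add_zero]
  | succ p =>
    obtain ⟨β, h1, h2, h3⟩ := hα
    obtain ⟨γ, k1, k2, k3⟩ := hη
    refine ⟨β + γ, h1.add k1, fun i x => ?_, ?_⟩
    · rw [Pi.add_apply, Pi.add_apply, h2, k2]
    · rw [extDeriv_add_smooth h1 k1, h3, k3]

theorem torusExact_zero : TorusExact (0 : Form ℂ n p) := by
  cases p with
  | zero => rfl
  | succ p =>
    refine ⟨0, contDiff_const, fun i x => rfl, ?_⟩
    exact extDeriv_sum (∅ : Finset Unit) (f := fun _ => 0) fun _ => contDiff_const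

theorem extDeriv_eq_zero_iff_of_zero {α : Form ℂ n 0} :
    extDeriv α = 0 ↔ fderiv ℝ α = 0 := by
  constructor
  · intro h
    funext x
    ext v : 1
    have h1 := interior_alternatizeUncurryFin_zero v (fderiv ℝ α x)
    rw [← extDeriv, h, Pi.zero_apply, map_zero] at h1
    rw [← h1]
    rfl
  · intro h
    funext x
    have h1 := map_zero (ContinuousAlternatingMap.alternatizeUncurryFinCLM ℝ (E n) ℂ (n := 0))
    rw [extDeriv, h]
    exact h1

/-- The primitive is `avg id i` of the contraction with eᵢ. Its differential is `avg id i` of d(ι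
α), which is ∂ᵢα by Cartan since α is closed, and integration by parts identifies the result with α
minus its average. -/
theorem torusExact_sub_avg (i : Fin n) {α : Form ℂ n p} (hα : ContDiff ℝ ∞ α) (hp : Periodic α)
    (hc : extDeriv α = 0) : TorusExact (α - avg (fun _ => 1) i α) := by
  rw [← partialD_avg_id i hα hp]
  cases p with
  | zero =>
    rw [TorusExact, partialD_avg continuous_id i i hα]
    have : partialD i α = 0 := funext fun x => by
      rw [partialD, extDeriv_eq_zero_iff_of_zero.1 hc]
      rfl
    rw [this, avg_zero]
  | succ p =>
    refine ⟨avg id i fun x => interior (stdVec i) (α x),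
      contDiff_avg continuous_id i (contDiff_interior _ hα), Periodic.avg (fun j x => ?_) _ i, ?_⟩
    · simp only [hp j x]
    · rw [extDeriv_avg continuous_id i (contDiff_interior _ hα),
        partialD_avg continuous_id i i hα]
      congr 1
      funext x
      rw [← cartan i hα x, hc, Pi.zero_apply, map_zero, zero_add]

theorem torusExact_sub_mean (l : List (Fin n)) {α : Form ℂ n p} (hα : ContDiff ℝ ∞ α)
    (hp : Periodic α) (hc : extDeriv α = 0) : TorusExact (α - mean l α) := by
  induction l generalizing α with
  | nil => rw [mean, sub_self]; exact torusExact_zero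
  | cons i l ih =>
    have h1 : extDeriv (avg (fun _ => 1) i α) = 0 := by
      rw [extDeriv_avg continuous_const i hα, hc, avg_zero]
    have h2 := (torusExact_sub_avg i hα hp hc).add
      (ih (contDiff_avg continuous_const i hα) (hp.avg _ i) h1)
    rwa [sub_add_sub_cancel] at h2

theorem torusExact_sub_meanValue {α : Form ℂ n p} (hα : ContDiff ℝ ∞ α)
    (hp : Periodic α) (hc : extDeriv α = 0) : TorusExact (α - fun _ => meanValue α) := by
  rw [← mean_finRange hα hp]
  exact torusExact_sub_mean _ hα hp hc

/-- The mean of the full derivative vanishes on each basis vector, and alternatization is linear.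
Consequently exact forms have mean zero, so no nonzero constant form is exact. -/
theorem meanValue_extDeriv {β : Form ℂ n p} (hβ : ContDiff ℝ ∞ β) (hp : Periodic β) :
    meanValue (extDeriv β) = 0 := by
  have h1 : ContDiff ℝ ∞ (fderiv ℝ β) := hβ.fderiv_right (by simp)
  have h2 : meanValue (fderiv ℝ β) = 0 := by
    have : ((meanValue (fderiv ℝ β) : E n →L[ℝ] Alt n p) : E n →ₗ[ℝ] Alt n p) = 0 :=
      (EuclideanSpace.basisFun (Fin n) ℝ).toBasis.ext fun i => by
        have h3 := meanValue_clm h1 (ContinuousLinearMap.apply ℝ (Alt n p) (stdVec i : E n))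
        have h4 := meanValue_partialD i hβ hp
        have h5 := h3.symm.trans h4
        simpa using h5
    ext v : 1
    exact LinearMap.congr_fun this v
  have h3 := meanValue_clm h1 (ContinuousAlternatingMap.alternatizeUncurryFinCLM ℝ (E n) ℂ (n := p))
  rw [h2, map_zero] at h3
  exact h3

theorem eq_zero_of_torusExact_const {c : Alt n p} (h : TorusExact fun _ : E n => c) : c = 0 := by
  cases p with
  | zero => exact congrFun h 0
  | succ p =>
    obtain ⟨β, h1, h2, h3⟩ := h
    rw [← meanValue_const (n := n) c, ← h3, meanValue_extDeriv h1 h2]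

end Forms

end FlatForms

namespace FlatForms

open scoped ContDiff Topology

/-! ### Coordinates of alternating forms -/

section Coordinates

open Set.powersetCard in
/-- The `p`-tuple of canonical basis vectors with indices in `I`, in increasing order. -/
noncomputable def basisTuple {n p : ℕ} (I : Set.powersetCard (Fin n) p) (j : Fin p) : E n :=
  stdVec (ofFinEmbEquiv.symm I j)

variable {n p : ℕ}

/-- Alternating maps are linear maps on the exterior power, which has the wedges of increasing basis
tuples as a basis. -/
theorem alternating_ext {F : Type} [NormedAddCommGroup F] [NormedSpace ℝ F]
    {η θ : E n [⋀^Fin p]→L[ℝ] F} (h : ∀ I : Set.powersetCard (Fin n) p,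
      η (basisTuple I) = θ (basisTuple I)) : η = θ := by
  have key : exteriorPower.alternatingMapLinearEquiv η.toAlternatingMap =
      exteriorPower.alternatingMapLinearEquiv θ.toAlternatingMap := by
    refine ((EuclideanSpace.basisFun (Fin n) ℝ).toBasis.exteriorPower p).ext fun I => ?_
    rw [exteriorPower.basis_apply, exteriorPower.ιMulti_family,
      exteriorPower.alternatingMapLinearEquiv_apply_ιMulti,
      exteriorPower.alternatingMapLinearEquiv_apply_ιMulti]
    have : ((EuclideanSpace.basisFun (Fin n) ℝ).toBasis ∘
        Set.powersetCard.ofFinEmbEquiv.symm I) = basisTuple I := by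
      funext j
      simp [basisTuple]
    rw [this]
    exact h I
  ext v
  exact DFunLike.congr_fun (exteriorPower.alternatingMapLinearEquiv.injective key) v

/-- The basis form `dx_I`. -/
noncomputable def basisForm (I : Set.powersetCard (Fin n) p) : E n [⋀^Fin p]→L[ℝ] ℝ :=
  { (exteriorPower.ιMultiDual ℝ p (EuclideanSpace.basisFun (Fin n) ℝ).toBasis
      I).compAlternatingMap (exteriorPower.ιMulti ℝ p) with
    cont := by
      change Continuous fun v : Fin p → E n => exteriorPower.ιMultiDual ℝ p
        (EuclideanSpace.basisFun (Fin n) ℝ).toBasis I (exteriorPower.ιMulti ℝ p v)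
      simp only [exteriorPower.ιMultiDual_apply_ιMulti]
      refine Continuous.matrix_det (continuous_matrix fun i j => ?_)
      simp only [Matrix.of_apply, Module.Basis.coord_apply, OrthonormalBasis.coe_toBasis_repr_apply,
        EuclideanSpace.basisFun_repr]
      fun_prop }

theorem basisForm_basisTuple (I J : Set.powersetCard (Fin n) p) :
    basisForm I (basisTuple J) = if I = J then 1 else 0 := by
  have h : basisTuple J = ((EuclideanSpace.basisFun (Fin n) ℝ).toBasis ∘
        Set.powersetCard.ofFinEmbEquiv.symm J) := by
    funext j
    simp [basisTuple]
  change exteriorPower.ιMultiDual ℝ p (EuclideanSpace.basisFun (Fin n) ℝ).toBasis I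
    (exteriorPower.ιMulti ℝ p (basisTuple J)) = _
  rw [h, ← exteriorPower.ιMulti_family]
  split_ifs with hIJ
  · subst hIJ
    exact exteriorPower.ιMultiDual_apply_diag _ _ _ _
  · exact exteriorPower.ιMultiDual_apply_nondiag _ _ _ _ _ hIJ

/-- Coordinates of complex alternating forms with respect to the forms `dx_I`. -/
noncomputable def altEquiv (n p : ℕ) : Alt n p ≃ₗ[ℂ] (Set.powersetCard (Fin n) p → ℂ) where
  toFun η I := η (basisTuple I)
  map_add' _ _ := rfl
  map_smul' _ _ := rfl
  invFun c := ∑ I, c I • Complex.ofRealCLM.compContinuousAlternatingMap (basisForm I)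
  left_inv η := by
    refine alternating_ext fun J => ?_
    simp [ContinuousAlternatingMap.sum_apply, basisForm_basisTuple, apply_ite Complex.ofReal]
  right_inv c := by
    funext J
    simp [ContinuousAlternatingMap.sum_apply, basisForm_basisTuple, apply_ite Complex.ofReal]

/-- `altEquiv` as a continuous real linear equivalence. -/
noncomputable def altCLE (n p : ℕ) : Alt n p ≃L[ℝ] (Set.powersetCard (Fin n) p → ℂ) :=
  have : FiniteDimensional ℝ (Alt n p) :=
    ((altEquiv n p).restrictScalars ℝ).symm.finiteDimensional
  ((altEquiv n p).restrictScalars ℝ).toContinuousLinearEquiv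

theorem altCLE_apply (η : Alt n p) (I : Set.powersetCard (Fin n) p) :
    altCLE n p η I = η (basisTuple I) := rfl

/-- The coefficient function of `dx_I` in a form. -/
noncomputable def coefficient (I : Set.powersetCard (Fin n) p) (α : Form ℂ n p) : E n → ℂ :=
  fun x => α x (basisTuple I)

/-- The form with given coefficient functions. -/
noncomputable def ofCoefficients (f : Set.powersetCard (Fin n) p → E n → ℂ) : Form ℂ n p :=
  fun x => (altCLE n p).symm fun I => f I x

theorem coefficient_ofCoefficients (f : Set.powersetCard (Fin n) p → E n → ℂ)
    (I : Set.powersetCard (Fin n) p) : coefficient I (ofCoefficients f) = f I := by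
  funext x
  rw [coefficient, ← altCLE_apply, ofCoefficients, ContinuousLinearEquiv.apply_symm_apply]

theorem form_ext {α β : Form ℂ n p} (h : ∀ I, coefficient I α = coefficient I β) : α = β :=
  funext fun x => alternating_ext fun I => congrFun (h I) x

/-- Evaluation of a form on a tuple of basis vectors, as a continuous linear map. -/
noncomputable def coordCLM (I : Set.powersetCard (Fin n) p) : Alt n p →L[ℝ] ℂ :=
  (ContinuousLinearMap.proj I).comp (altCLE n p : Alt n p →L[ℝ] Set.powersetCard (Fin n) p → ℂ)

theorem coefficient_eq (I : Set.powersetCard (Fin n) p) (α : Form ℂ n p) :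
    coefficient I α = fun x => coordCLM I (α x) := rfl

theorem contDiff_coefficient (I : Set.powersetCard (Fin n) p) {α : Form ℂ n p}
    (hα : ContDiff ℝ ∞ α) : ContDiff ℝ ∞ (coefficient I α) :=
  (coordCLM I).contDiff.comp hα

theorem contDiff_ofCoefficients {f : Set.powersetCard (Fin n) p → E n → ℂ}
    (hf : ∀ I, ContDiff ℝ ∞ (f I)) : ContDiff ℝ ∞ (ofCoefficients f) :=
  (altCLE n p).symm.contDiff.comp (contDiff_pi.2 hf)

theorem partialD_clm {F F' : Type} [NormedAddCommGroup F] [NormedSpace ℝ F]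
    [NormedAddCommGroup F'] [NormedSpace ℝ F'] (L : F →L[ℝ] F') {f : E n → F}
    (hf : ContDiff ℝ ∞ f) (i : Fin n) :
    partialD i (fun x => L (f x)) = fun x => L (partialD i f x) := by
  funext x
  have := (L.hasFDerivAt.comp x (hf.differentiable (by simp) x).hasFDerivAt).fderiv
  exact congrArg (fun T => T (stdVec i)) this

theorem laplacian_clm {F F' : Type} [NormedAddCommGroup F] [NormedSpace ℝ F]
    [NormedAddCommGroup F'] [NormedSpace ℝ F'] (L : F →L[ℝ] F') {f : E n → F}
    (hf : ContDiff ℝ ∞ f) : laplacian (fun x => L (f x)) = fun x => L (laplacian f x) := by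
  funext x
  simp only [laplacian, partialD_clm L hf, partialD_clm L (contDiff_partialD _ hf), map_neg,
    map_sum]

theorem coefficient_hodgeLaplacian (I : Set.powersetCard (Fin n) p) {α : Form ℂ n p}
    (hα : ContDiff ℝ ∞ α) :
    coefficient I (hodgeLaplacian α) = laplacian (coefficient I α) := by
  rw [hodgeLaplacian_eq hα, coefficient_eq, coefficient_eq, laplacian_clm _ hα]

theorem periodic_iff_coefficient {α : Form ℂ n p} :
    Periodic α ↔ ∀ I, Periodic (coefficient I α) :=
  ⟨fun h I i x => by rw [coefficient, coefficient, h],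
    fun h i x => alternating_ext fun I => h I i x⟩

end Coordinates

end FlatForms

namespace FlatForms

open scoped ContDiff Topology

/-! ### The groups `⟨B L_{e₁/2}, L_Λ⟩` -/

section Groups

theorem mem_canonicalLattice {n : ℕ} {v : E n} :
    v ∈ canonicalLattice n ↔ ∀ i, ∃ m : ℤ, v i = m := by
  have h := Module.Basis.mem_span_iff_repr_mem ℤ (EuclideanSpace.basisFun (Fin n) ℝ).toBasis v
  have h2 : Set.range (EuclideanSpace.basisFun (Fin n) ℝ).toBasis =
      Set.range fun i : Fin n => (EuclideanSpace.single i (1 : ℝ) : E n) := by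
    congr 1
    funext i
    simp
  rw [h2] at h
  rw [canonicalLattice, h]
  simp [eq_comm]

theorem diagSign_apply (k : ℕ) (x : E 9) (i : Fin 9) :
    diagSign k x i = if (i : ℕ) < k then x i else -x i := by
  simp only [diagSign, LinearIsometryEquiv.piLpCongrRight_apply]
  split_ifs <;> rfl

/-- The generator `C L_{e₁/2}` of `diagGroup k`. -/
noncomputable def generator (k : ℕ) : Isom 9 :=
  (diagSign k).toAffineIsometryEquiv * translation (EuclideanSpace.single 0 (1 / 2))

theorem generator_apply (k : ℕ) (x : E 9) :
    generator k x = diagSign k (EuclideanSpace.single 0 (1 / 2) + x) := rfl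

theorem translation_apply {n : ℕ} (b x : E n) : translation b x = b + x := rfl

theorem linearPart_translation {n : ℕ} (b : E n) : linearPart n (translation b) = 1 := rfl

theorem linearPart_generator (k : ℕ) : linearPart 9 (generator k) = diagSign k := by
  rw [generator, map_mul, linearPart_translation, mul_one]
  rfl

theorem isom_apply {n : ℕ} (γ : Isom n) (x : E n) : γ x = linearPart n γ x + γ 0 := by
  have h : γ x = γ.linearIsometryEquiv x + γ 0 := by simpa using γ.map_vadd 0 x
  exact h

theorem isom_ext {n : ℕ} {γ δ : Isom n} (h : linearPart n γ = linearPart n δ) (h0 : γ 0 = δ 0) :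
    γ = δ := by
  ext1 x
  rw [isom_apply γ, isom_apply δ, h, h0]

theorem diagSign_mul_self (k : ℕ) : diagSign k * diagSign k = 1 := by
  ext x i
  change diagSign k (diagSign k x) i = x i
  rw [diagSign_apply, diagSign_apply]
  split_ifs <;> simp

theorem diagSign_single_zero {k : ℕ} (hk : 0 < k) (c : ℝ) :
    diagSign k (EuclideanSpace.single 0 c) = EuclideanSpace.single 0 c := by
  ext i
  rw [diagSign_apply]
  by_cases hi : i = 0
  · subst hi; simp [hk]
  · simp [hi]

theorem diagSign_mem {k : ℕ} {v : E 9} (hv : v ∈ canonicalLattice 9) :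
    diagSign k v ∈ canonicalLattice 9 := by
  rw [mem_canonicalLattice] at *
  intro i
  obtain ⟨m, hm⟩ := hv i
  rw [diagSign_apply, hm]
  split_ifs
  · exact ⟨m, rfl⟩
  · exact ⟨-m, by simp⟩

theorem diagSign_ne_one {k : ℕ} (hk : k < 9) : diagSign k ≠ 1 := by
  intro h
  have h1 := diagSign_apply k (EuclideanSpace.single 8 1) 8
  rw [h, if_neg (by simpa using by omega)] at h1
  have h2 : (1 : ℝ) = -1 := by simpa using h1
  norm_num at h2

theorem half_notMem : (EuclideanSpace.single 0 (1 / 2) : E 9) ∉ canonicalLattice 9 := by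
  rw [mem_canonicalLattice]
  intro h
  obtain ⟨m, hm⟩ := h 0
  have h1 : (1 : ℝ) = 2 * m := by
    have : (1 / 2 : ℝ) = m := by simpa using hm
    linarith
  have h2 : (1 : ℤ) = 2 * m := by exact_mod_cast h1
  omega

theorem single_one_mem {n : ℕ} (i : Fin n) : stdVec i ∈ canonicalLattice n :=
  Submodule.subset_span ⟨i, rfl⟩

/-- An explicit description of the elements of `diagGroup k`. -/
theorem mem_diagGroup {k : ℕ} (hk : 0 < k) {γ : Isom 9} :
    γ ∈ diagGroup k ↔ (linearPart 9 γ = 1 ∧ γ 0 ∈ canonicalLattice 9) ∨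
      (linearPart 9 γ = diagSign k ∧ γ 0 - EuclideanSpace.single 0 (1 / 2) ∈
        canonicalLattice 9) := by
  constructor
  · intro h
    refine Subgroup.closure_induction (p := fun γ _ =>
      (linearPart 9 γ = 1 ∧ γ 0 ∈ canonicalLattice 9) ∨
      (linearPart 9 γ = diagSign k ∧ γ 0 - EuclideanSpace.single 0 (1 / 2) ∈
        canonicalLattice 9)) ?_ ?_ ?_ ?_ h
    · rintro γ (hγ | ⟨v, hv, rfl⟩)
      · rw [Set.mem_singleton_iff] at hγ
        rw [hγ]
        refine Or.inr ⟨linearPart_generator k, ?_⟩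
        have h1 := generator_apply k 0
        rw [add_zero, diagSign_single_zero hk] at h1
        change generator k 0 - _ ∈ _
        rw [h1, sub_self]
        exact zero_mem _
      · refine Or.inl ⟨rfl, ?_⟩
        rw [translation_apply, add_zero]
        exact hv
    · exact Or.inl ⟨rfl, zero_mem _⟩
    · intro γ δ _ _ hγ hδ
      have h0 : (γ * δ) 0 = linearPart 9 γ (δ 0) + γ 0 := isom_apply γ (δ 0)
      rw [h0, map_mul]
      rcases hγ with ⟨g1, g2⟩ | ⟨g1, g2⟩ <;> rcases hδ with ⟨d1, d2⟩ | ⟨d1, d2⟩ <;> rw [g1, d1]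
      · exact Or.inl ⟨mul_one _, add_mem d2 g2⟩
      · refine Or.inr ⟨one_mul _, ?_⟩
        have := add_mem d2 g2
        rwa [sub_add_eq_add_sub] at this
      · refine Or.inr ⟨mul_one _, ?_⟩
        rw [add_sub_assoc]
        exact add_mem (diagSign_mem d2) g2
      · refine Or.inl ⟨diagSign_mul_self k, ?_⟩
        have h1 := diagSign_mem (k := k) d2
        rw [map_sub, diagSign_single_zero hk] at h1
        -- The two half-translations lie along a direction fixed by the linear part, so they add up
        -- to a full basis vector, which is in the lattice.
        have h2 := add_mem (add_mem h1 g2) (single_one_mem (0 : Fin 9))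
        convert h2 using 1
        ext i
        by_cases hi : i = 0
        · subst hi; simp; ring
        · simp [hi]
    · intro γ _ hγ
      have h0 : γ⁻¹ 0 = -(linearPart 9 γ)⁻¹ (γ 0) := by
        have h1 := isom_apply γ⁻¹ (γ 0)
        have h2 : γ⁻¹ (γ 0) = 0 := γ.symm_apply_apply 0
        rw [h2, map_inv] at h1
        exact (neg_eq_of_add_eq_zero_right h1.symm).symm
      rw [h0, map_inv]
      rcases hγ with ⟨g1, g2⟩ | ⟨g1, g2⟩ <;> rw [g1]
      · rw [inv_one]
        exact Or.inl ⟨rfl, neg_mem g2⟩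
      · rw [inv_eq_of_mul_eq_one_right (diagSign_mul_self k)]
        refine Or.inr ⟨rfl, ?_⟩
        have h1 := diagSign_mem (k := k) g2
        rw [map_sub, diagSign_single_zero hk] at h1
        have h2 := neg_mem (add_mem h1 (single_one_mem (0 : Fin 9)))
        convert h2 using 1
        ext i
        by_cases hi : i = 0
        · subst hi; simp; ring
        · simp [hi]
  · rintro (⟨h1, h2⟩ | ⟨h1, h2⟩)
    · have : γ = translation (γ 0) := isom_ext h1 (by rw [translation_apply, add_zero])
      rw [this]
      exact Subgroup.subset_closure (Or.inr ⟨_, h2, rfl⟩)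
    · have : γ = generator k * translation (diagSign k (γ 0 - EuclideanSpace.single 0 (1 / 2))) := by
        refine isom_ext ?_ ?_
        · rw [h1, map_mul, linearPart_translation, mul_one, linearPart_generator]
        · change _ = generator k (translation _ 0)
          rw [translation_apply, add_zero, generator_apply, map_add, diagSign_single_zero hk]
          have h3 : diagSign k (diagSign k (γ 0 - EuclideanSpace.single 0 (1 / 2))) =
              γ 0 - EuclideanSpace.single 0 (1 / 2) :=
            DFunLike.congr_fun (diagSign_mul_self k) _
          rw [h3, add_sub_cancel]
      rw [this]
      exact mul_mem (Subgroup.subset_closure (Or.inl rfl))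
        (Subgroup.subset_closure (Or.inr ⟨_, diagSign_mem h2, rfl⟩))

theorem generator_mem (k : ℕ) : generator k ∈ diagGroup k :=
  Subgroup.subset_closure (Or.inl rfl)

theorem translation_mem {k : ℕ} {v : E 9} (hv : v ∈ canonicalLattice 9) :
    translation v ∈ diagGroup k :=
  Subgroup.subset_closure (Or.inr ⟨v, hv, rfl⟩)

theorem translation_mem_iff {k : ℕ} (hk : 0 < k) (hk' : k < 9) (v : E 9) :
    translation v ∈ diagGroup k ↔ v ∈ canonicalLattice 9 := by
  refine ⟨fun h => ?_, translation_mem⟩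
  rcases (mem_diagGroup hk).1 h with ⟨_, h2⟩ | ⟨h1, _⟩
  · rwa [translation_apply, add_zero] at h2
  · exact absurd h1.symm (diagSign_ne_one hk')

/-! ### Torsion-freeness, cocompactness, discreteness and holonomy. -/

theorem linearPart_apply_zero {k : ℕ} (hk : 0 < k) {γ : Isom 9} (hγ : γ ∈ diagGroup k) (x : E 9) :
    linearPart 9 γ x 0 = x 0 := by
  rcases (mem_diagGroup hk).1 hγ with ⟨h1, _⟩ | ⟨h1, _⟩
  · rw [h1]; rfl
  · rw [h1, diagSign_apply, if_pos (by simpa using hk)]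

/-- In a coordinate fixed by the linear part, γ^j translates by j times the translation of γ, so
finite order forces that translation to vanish. For elements with nontrivial linear part the first
coordinate is fixed and its translation is a half-integer, hence nonzero. -/
theorem eq_one_of_isOfFinOrder {k : ℕ} (hk : 0 < k) {γ : Isom 9} (hγ : γ ∈ diagGroup k)
    (h : IsOfFinOrder γ) : γ = 1 := by
  obtain ⟨m, hm, hγm⟩ := isOfFinOrder_iff_pow_eq_one.1 h
  have key : ∀ (i : Fin 9), (∀ x, linearPart 9 γ x i = x i) → γ 0 i = 0 := by
    intro i hi
    have h1 : ∀ j : ℕ, (γ ^ j) 0 i = j * γ 0 i := by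
      intro j
      induction j with
      | zero => simp
      | succ j ih =>
        have h2 : (γ ^ (j + 1)) 0 = γ ((γ ^ j) 0) := by rw [pow_succ']; rfl
        rw [h2, isom_apply, PiLp.add_apply, hi, ih]
        push_cast
        ring
    have h2 := h1 m
    rw [hγm] at h2
    have h3 : (m : ℝ) * γ 0 i = 0 := by rw [← h2]; rfl
    exact (mul_eq_zero.1 h3).resolve_left (by exact_mod_cast hm.ne')
  rcases (mem_diagGroup hk).1 hγ with ⟨h1, h2⟩ | ⟨h1, h2⟩
  · refine isom_ext h1 ?_
    ext i
    exact key i fun x => by rw [h1]; rfl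
  · exfalso
    have h3 := key 0 (linearPart_apply_zero hk hγ)
    obtain ⟨m, hm⟩ := mem_canonicalLattice.1 h2 0
    rw [PiLp.sub_apply, h3] at hm
    have h4 : -(1 / 2 : ℝ) = m := by simpa using hm
    have h5 : (-1 : ℝ) = 2 * m := by linarith
    have h6 : (-1 : ℤ) = 2 * m := by exact_mod_cast h5
    omega

/-- The lattice alone moves every point into a bounded fundamental domain, so a closed ball surjects
onto the quotient. -/
theorem compactSpace_flatQuotient (k : ℕ) : CompactSpace (FlatQuotient (diagGroup k)) := by
  let b := (EuclideanSpace.basisFun (Fin 9) ℝ).toBasis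
  have hb : Submodule.span ℤ (Set.range b) = canonicalLattice 9 := by
    rw [canonicalLattice]
    congr 2
    funext i
    simp [b]
  have hK : IsCompact (Metric.closedBall (0 : E 9) (∑ i, ‖b i‖)) := isCompact_closedBall _ _
  refine ⟨?_⟩
  have himg : (Quotient.mk (orbitSetoid (diagGroup k))) '' (Metric.closedBall (0 : E 9)
      (∑ i, ‖b i‖)) = Set.univ := by
    refine Set.eq_univ_of_forall fun q => ?_
    obtain ⟨x, rfl⟩ := Quotient.exists_rep q
    refine ⟨ZSpan.fract b x, ?_, Quotient.sound ⟨translation (ZSpan.floor b x : E 9),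
      translation_mem ?_, ?_⟩⟩
    · rw [mem_closedBall_zero_iff]
      exact ZSpan.norm_fract_le b x
    · rw [← hb]
      exact (ZSpan.floor b x).2
    · rw [translation_apply, ZSpan.fract_apply, add_sub_cancel]
  rw [← himg]
  exact hK.image continuous_quotient_mk'

/-- Evaluation γ ↦ 2γ(0) is continuous into the discrete lattice. It is injective because γ(0)
determines the linear part: trivial if γ(0) is in the lattice, nontrivial if it is in the disjoint
coset shifted by a half. -/
theorem discreteTopology_diagGroup {k : ℕ} (hk : 0 < k) :
    DiscreteTopology (Set.range fun γ : diagGroup k => (γ.1 : E 9 → E 9)) := by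
  let b := (EuclideanSpace.basisFun (Fin 9) ℝ).toBasis
  have hb : Submodule.span ℤ (Set.range b) = canonicalLattice 9 := by
    rw [canonicalLattice]
    congr 2
    funext i
    simp [b]
  have : DiscreteTopology (canonicalLattice 9) := by
    rw [← hb]
    infer_instance
  have hmem : ∀ f ∈ Set.range fun γ : diagGroup k => (γ.1 : E 9 → E 9),
      f 0 + f 0 ∈ canonicalLattice 9 := by
    rintro _ ⟨⟨γ, hγ⟩, rfl⟩
    change γ 0 + γ 0 ∈ _
    rcases (mem_diagGroup hk).1 hγ with ⟨_, h2⟩ | ⟨_, h2⟩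
    · exact add_mem h2 h2
    · have h3 := add_mem (add_mem h2 h2) (single_one_mem (0 : Fin 9))
      convert h3 using 1
      ext i
      by_cases hi : i = 0
      · subst hi; simp; ring
      · simp [hi]
  let Φ : (Set.range fun γ : diagGroup k => (γ.1 : E 9 → E 9)) → canonicalLattice 9 :=
    fun f => ⟨f.1 0 + f.1 0, hmem f.1 f.2⟩
  refine DiscreteTopology.of_continuous_injective (f := Φ) ?_ ?_
  · refine Continuous.subtype_mk ?_ _
    have : Continuous fun f : (Set.range fun γ : diagGroup k => (γ.1 : E 9 → E 9)) => f.1 0 :=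
      (continuous_apply 0).comp continuous_subtype_val
    exact this.add this
  · rintro ⟨_, ⟨γ, hγ⟩, rfl⟩ ⟨_, ⟨δ, hδ⟩, rfl⟩ h
    have h1 : γ 0 + γ 0 = δ 0 + δ 0 := congrArg Subtype.val h
    have h0 : γ 0 = δ 0 := by
      rw [← two_smul ℝ, ← two_smul ℝ] at h1
      exact smul_right_injective (E 9) (two_ne_zero' ℝ) h1
    have hd : ∀ {v : E 9}, v ∈ canonicalLattice 9 →
        v - EuclideanSpace.single 0 (1 / 2) ∉ canonicalLattice 9 := fun hv hv' => by
      have := sub_mem hv hv'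
      rw [sub_sub_cancel] at this
      exact half_notMem this
    have hl : linearPart 9 γ = linearPart 9 δ := by
      rcases (mem_diagGroup hk).1 hγ with ⟨g1, g2⟩ | ⟨g1, g2⟩ <;>
      rcases (mem_diagGroup hk).1 hδ with ⟨d1, d2⟩ | ⟨d1, d2⟩
      · rw [g1, d1]
      · rw [h0] at g2; exact absurd d2 (hd g2)
      · rw [h0] at g2; exact absurd g2 (hd d2)
      · rw [g1, d1]
    have : γ = δ := isom_ext hl h0
    subst this
    rfl

theorem isBieberbach_diagGroup {k : ℕ} (hk : 0 < k) : IsBieberbach (diagGroup k) where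
  discrete := discreteTopology_diagGroup hk
  cocompact := compactSpace_flatQuotient k
  torsionFree _ hγ h h' := h (eq_one_of_isOfFinOrder hk hγ h')

theorem nonempty_holonomyGroup_mulEquiv {k : ℕ} (hk : 0 < k) (hk' : k < 9) :
    Nonempty (holonomyGroup (diagGroup k) ≃* Multiplicative (ZMod 2)) := by
  have h1 : holonomyGroup (diagGroup k) = Subgroup.zpowers (diagSign k) := by
    apply le_antisymm
    · rintro _ ⟨γ, hγ, rfl⟩
      rcases (mem_diagGroup hk).1 hγ with ⟨g1, _⟩ | ⟨g1, _⟩ <;> rw [g1]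
      · exact one_mem _
      · exact Subgroup.mem_zpowers _
    · rw [Subgroup.zpowers_le]
      exact ⟨generator k, generator_mem k, linearPart_generator k⟩
  have h2 : Nat.card (holonomyGroup (diagGroup k)) = 2 := by
    rw [h1, Nat.card_zpowers]
    refine orderOf_eq_prime ?_ (diagSign_ne_one hk')
    rw [pow_two, diagSign_mul_self]
  have : Fact (Nat.Prime 2) := ⟨Nat.prime_two⟩
  exact ⟨mulEquivOfPrimeCardEq (p := 2) h2 (by simp)⟩

end Groups

end FlatForms

namespace FlatForms

open scoped ContDiff Topology

/-! ### Invariant forms and orientability -/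

section Invariant

theorem fderiv_isom {n : ℕ} (γ : Isom n) (x : E n) :
    fderiv ℝ γ x = ((linearPart n γ).toContinuousLinearEquiv : E n →L[ℝ] E n) := by
  have h : (γ : E n → E n) = fun x =>
      ((linearPart n γ).toContinuousLinearEquiv : E n →L[ℝ] E n) x + γ 0 :=
    funext fun x => isom_apply γ x
  rw [h]
  exact ((((linearPart n γ).toContinuousLinearEquiv : E n →L[ℝ] E n).hasFDerivAt).add_const
    _).fderiv

variable {𝕜 : Type} [NormedField 𝕜] [NormedAlgebra ℝ 𝕜] {n p : ℕ}

theorem pullback_apply (γ : Isom n) (α : Form 𝕜 n p) (x : E n) (v : Fin p → E n) :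
    pullback γ α x v = α (γ x) fun j => linearPart n γ (v j) := by
  rw [pullback, fderiv_isom]
  rfl

theorem pullback_mul (γ δ : Isom n) (α : Form 𝕜 n p) :
    pullback ⇑(γ * δ) α = pullback δ (pullback γ α) := by
  funext x
  ext v
  simp only [pullback_apply, map_mul]
  rfl

theorem pullback_one (α : Form 𝕜 n p) : pullback ⇑(1 : Isom n) α = α := by
  funext x
  ext v
  rw [pullback_apply, map_one]
  rfl

theorem pullback_translation (b : E n) (α : Form 𝕜 n p) :
    pullback (translation b) α = fun x => α (x + b) := by
  funext x
  ext v
  rw [pullback_apply, translation_apply, linearPart_translation, add_comm]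
  rfl

theorem Periodic.add_mem {F : Type} [NormedAddCommGroup F] [NormedSpace ℝ F] {f : E n → F}
    (hf : Periodic f) {v : E n} (hv : v ∈ canonicalLattice n) : ∀ x, f (x + v) = f x := by
  let H : AddSubgroup (E n) :=
    { carrier := {v | ∀ x, f (x + v) = f x}
      zero_mem' := fun x => by rw [add_zero]
      add_mem' := fun {a b} ha hb x => by rw [← add_assoc, hb, ha]
      neg_mem' := fun {a} ha x => by rw [← ha (x + -a), neg_add_cancel_right] }
  have h : canonicalLattice n ≤ AddSubgroup.toIntSubmodule H := by
    rw [canonicalLattice, Submodule.span_le]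
    rintro _ ⟨i, rfl⟩
    exact hf i
  exact h hv

/-- Pullback is contravariantly multiplicative, so invariance need only be tested on generators of
the group. -/
theorem mem_smoothForms_diagGroup {k : ℕ} {α : Form 𝕜 9 p} :
    α ∈ smoothForms 𝕜 (diagGroup k) p ↔
      ContDiff ℝ ∞ α ∧ Periodic α ∧ pullback (generator k) α = α := by
  constructor
  · rintro ⟨h1, h2⟩
    refine ⟨h1, fun i x => ?_, h2 _ (generator_mem k)⟩
    have h3 := h2 _ (translation_mem (k := k) (single_one_mem i))
    rw [pullback_translation] at h3
    exact congrFun h3 x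
  · rintro ⟨h1, h2, h3⟩
    refine ⟨h1, fun γ hγ => ?_⟩
    refine Subgroup.closure_induction (p := fun (γ : Isom 9) _ => pullback γ α = α) ?_
      (pullback_one α) ?_ ?_ hγ
    · rintro γ (hγ | ⟨v, hv, rfl⟩)
      · rw [Set.mem_singleton_iff] at hγ
        rw [hγ]
        exact h3
      · rw [pullback_translation]
        exact funext (h2.add_mem hv)
    · intro γ δ _ _ hγ hδ
      rw [pullback_mul, hγ, hδ]
    · intro γ _ hγ
      have h4 := pullback_mul γ γ⁻¹ α
      rw [mul_inv_cancel, pullback_one, hγ] at h4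
      exact h4.symm

/-! ### Signs on basis forms and orientability. -/

/-- The `i`-th diagonal entry of `diagSign k`. -/
def entry (k : ℕ) (i : Fin 9) : ℤ := if (i : ℕ) < k then 1 else -1

/-- The sign with which `diagSign k` acts on the form `dx_I`. -/
def formSign (k : ℕ) (I : Finset (Fin 9)) : ℤ := ∏ i ∈ I, entry k i

theorem entry_mul_self (k : ℕ) (i : Fin 9) : entry k i * entry k i = 1 := by
  rw [entry]; split_ifs <;> rfl

theorem formSign_mul_self (k : ℕ) (I : Finset (Fin 9)) : formSign k I * formSign k I = 1 := by
  rw [formSign, ← Finset.prod_mul_distrib]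
  exact Finset.prod_eq_one fun i _ => entry_mul_self k i

theorem diagSign_apply' (k : ℕ) (x : E 9) (i : Fin 9) : diagSign k x i = entry k i * x i := by
  rw [diagSign_apply, entry]
  split_ifs <;> simp

theorem diagSign_stdVec (k : ℕ) (i : Fin 9) :
    diagSign k (stdVec i) = (entry k i : ℝ) • stdVec i := by
  ext j
  rw [diagSign_apply', PiLp.smul_apply, smul_eq_mul]
  by_cases h : j = i
  · rw [h]
  · simp [h]

theorem apply_diagSign_basisTuple {F : Type} [NormedAddCommGroup F] [NormedSpace ℝ F] (k : ℕ)
    (η : E 9 [⋀^Fin p]→L[ℝ] F) (I : Set.powersetCard (Fin 9) p) :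
    (η fun j => diagSign k (basisTuple I j)) = (formSign k I : ℝ) • η (basisTuple I) := by
  simp only [basisTuple, diagSign_stdVec]
  have h := η.toMultilinearMap.map_smul_univ
    (fun j => (entry k (Set.powersetCard.ofFinEmbEquiv.symm I j) : ℝ)) (basisTuple I)
  refine h.trans ?_
  congr 1
  rw [formSign, ← Finset.map_orderEmbOfFin_univ I.1 I.2, Finset.prod_map, Int.cast_prod]
  rfl

theorem pullback_generator_basisTuple (k : ℕ) (α : Form 𝕜 9 p) (x : E 9)
    (I : Set.powersetCard (Fin 9) p) :
    pullback (generator k) α x (basisTuple I) =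
      (formSign k I : ℝ) • α (generator k x) (basisTuple I) := by
  rw [pullback_apply, linearPart_generator]
  exact apply_diagSign_basisTuple k _ I

/-- The top-degree index set. -/
def topIndex : Set.powersetCard (Fin 9) 9 := ⟨Finset.univ, rfl⟩

theorem eq_topIndex (I : Set.powersetCard (Fin 9) 9) : I = topIndex :=
  Subtype.ext (Finset.card_eq_iff_eq_univ _ |>.1 I.2)

/-- The constant volume form is invariant exactly because its sign is 1. -/
theorem orientable_of_formSign {k : ℕ} (h : formSign k Finset.univ = 1) :
    Orientable (diagGroup k) := by
  refine ⟨fun _ => basisForm topIndex, mem_smoothForms_diagGroup.2 ⟨contDiff_const,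
    fun _ _ => rfl, ?_⟩, fun x hx => ?_⟩
  · funext x
    refine alternating_ext fun I => ?_
    rw [pullback_generator_basisTuple, eq_topIndex I]
    change ((formSign k Finset.univ : ℤ) : ℝ) • _ = _
    rw [h, Int.cast_one, one_smul]
  · have h1 := basisForm_basisTuple (topIndex : Set.powersetCard (Fin 9) 9) topIndex
    change basisForm topIndex = 0 at hx
    rw [hx] at h1
    simp at h1

/-- The single coefficient of an invariant top form changes sign along the generator, so by
connectedness of ℝ⁹ it vanishes somewhere. -/
theorem not_orientable_of_formSign {k : ℕ} (h : formSign k Finset.univ = -1) :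
    ¬ Orientable (diagGroup k) := by
  rintro ⟨α, hα, h0⟩
  obtain ⟨h1, -, h3⟩ := mem_smoothForms_diagGroup.1 hα
  have hneg : ∀ x, α (generator k x) (basisTuple topIndex) = -α x (basisTuple topIndex) := by
    intro x
    have h4 := pullback_generator_basisTuple k α x topIndex
    rw [h3] at h4
    change _ = ((formSign k Finset.univ : ℤ) : ℝ) • _ at h4
    rw [h, Int.cast_neg, Int.cast_one, neg_one_smul] at h4
    rw [h4, neg_neg]
  have hcont : Continuous fun x => α x (basisTuple topIndex) :=
    h1.continuous.eval_const _
  obtain ⟨x, hx⟩ : ∃ x, α x (basisTuple topIndex) = 0 := by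
    rcases le_total (α 0 (basisTuple topIndex)) 0 with h5 | h5
    · exact mem_range_of_exists_le_of_exists_ge hcont ⟨0, h5⟩
        ⟨generator k 0, by rw [hneg]; exact neg_nonneg.2 h5⟩
    · exact mem_range_of_exists_le_of_exists_ge hcont
        ⟨generator k 0, by rw [hneg]; exact neg_nonpos.2 h5⟩ ⟨0, h5⟩
  exact h0 x (alternating_ext fun I => by rw [eq_topIndex I, hx]; rfl)

end Invariant

end FlatForms

namespace FlatForms

open scoped ContDiff Topology

/-! ### Spaces of scalar eigenfunctions -/

section Scalar

variable {n : ℕ} {F : Type} [NormedAddCommGroup F] [NormedSpace ℝ F]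

theorem partialD_add (i : Fin n) {f g : E n → F} (hf : ContDiff ℝ ∞ f) (hg : ContDiff ℝ ∞ g) :
    partialD i (f + g) = partialD i f + partialD i g := by
  funext x
  rw [partialD, fderiv_add (hf.differentiable (by simp) x) (hg.differentiable (by simp) x)]
  rfl

theorem partialD_smul (i : Fin n) (c : ℂ) {f : E n → ℂ} (hf : ContDiff ℝ ∞ f) :
    partialD i (c • f) = c • partialD i f := by
  funext x
  rw [partialD, fderiv_const_smul (hf.differentiable (by simp) x) c]
  rfl

theorem laplacian_add {f g : E n → F} (hf : ContDiff ℝ ∞ f) (hg : ContDiff ℝ ∞ g) :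
    laplacian (f + g) = laplacian f + laplacian g := by
  funext x
  simp only [laplacian, partialD_add _ hf hg, Pi.add_apply,
    partialD_add _ (contDiff_partialD _ hf) (contDiff_partialD _ hg), Finset.sum_add_distrib,
    neg_add]

theorem contDiff_smul_pi (c : ℂ) {f : E n → ℂ} (hf : ContDiff ℝ ∞ f) : ContDiff ℝ ∞ (c • f) :=
  contDiff_const.mul hf

theorem laplacian_smul (c : ℂ) {f : E n → ℂ} (hf : ContDiff ℝ ∞ f) :
    laplacian (c • f) = c • laplacian f := by
  funext x
  simp only [laplacian, partialD_smul _ c hf, Pi.smul_apply,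
    partialD_smul _ c (contDiff_partialD _ hf), ← Finset.smul_sum, smul_neg]

theorem laplacian_const (c : F) : laplacian (fun _ : E n => c) = 0 := by
  have h : ∀ i, partialD i (fun _ : E n => c) = fun _ => 0 := fun i => by
    funext x
    simp [partialD]
  funext x
  simp [laplacian, h, partialD]

theorem laplacian_chi (a : Fin n → ℤ) :
    laplacian (chi a) = ((4 * Real.pi ^ 2 * ∑ i, (a i : ℝ) ^ 2 : ℝ) : ℂ) • chi a := by
  funext x
  have h : ∀ i, partialD i (partialD i (chi a)) x =
      (2 * Real.pi * Complex.I * a i) ^ 2 * chi a x := by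
    intro i
    have h1 : partialD i (chi a) = (2 * Real.pi * Complex.I * a i : ℂ) • chi a := partialD_chi a i
    rw [h1, partialD_smul _ _ (contDiff_chi a), h1]
    simp only [Pi.smul_apply, smul_eq_mul]
    ring
  simp only [laplacian, h, ← Finset.sum_mul, Pi.smul_apply, smul_eq_mul, mul_pow, Complex.I_sq,
    ← Finset.mul_sum]
  push_cast
  ring

/-- Smooth periodic functions with `-∑ᵢ ∂ᵢ² f = t f`. -/
def periodicEigenspace (n : ℕ) (t : ℝ) : Submodule ℂ (E n → ℂ) where
  carrier := {f | ContDiff ℝ ∞ f ∧ Periodic f ∧ laplacian f = (t : ℂ) • f}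
  zero_mem' := ⟨contDiff_const, fun _ _ => rfl, by
    rw [smul_zero]; exact laplacian_const 0⟩
  add_mem' := by
    rintro f g ⟨hf, hf', hf''⟩ ⟨hg, hg', hg''⟩
    refine ⟨hf.add hg, fun i x => ?_, ?_⟩
    · rw [Pi.add_apply, Pi.add_apply, hf', hg']
    · rw [laplacian_add hf hg, hf'', hg'', smul_add]
  smul_mem' := by
    rintro c f ⟨hf, hf', hf''⟩
    refine ⟨contDiff_smul_pi c hf, fun i x => ?_, ?_⟩
    · rw [Pi.smul_apply, Pi.smul_apply, hf']
    · rw [laplacian_smul c hf, hf'', smul_comm]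

/-- Smooth periodic eigenfunctions that are multiplied by `s` under the generator of
`diagGroup k`. -/
def scalarSpace (k : ℕ) (s : ℤ) (t : ℝ) : Submodule ℂ (E 9 → ℂ) where
  carrier := {f | f ∈ periodicEigenspace 9 t ∧ ∀ x, f (generator k x) = s * f x}
  zero_mem' := ⟨zero_mem _, fun x => by simp⟩
  add_mem' := by
    rintro f g ⟨hf, hf'⟩ ⟨hg, hg'⟩
    exact ⟨add_mem hf hg, fun x => by simp only [Pi.add_apply, hf', hg', mul_add]⟩
  smul_mem' := by
    rintro c f ⟨hf, hf'⟩
    refine ⟨Submodule.smul_mem _ c hf, fun x => ?_⟩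
    simp only [Pi.smul_apply, hf', smul_eq_mul]
    ring

/-! ### The generator acting on scalar functions. -/

theorem generator_apply_coord {k : ℕ} (hk : 0 < k) (x : E 9) (i : Fin 9) :
    generator k x i = entry k i * x i + if i = 0 then 1 / 2 else 0 := by
  rw [generator_apply, diagSign_apply', PiLp.add_apply]
  by_cases hi : i = 0
  · subst hi
    simp [entry, hk]
    ring
  · simp [hi]

/-- The square of the generator is a lattice translation, so composition with it is an involution on
periodic functions and splits them into even and odd parts. -/
theorem generator_generator {k : ℕ} (hk : 0 < k) (x : E 9) :
    generator k (generator k x) = x + stdVec 0 := by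
  ext i
  rw [generator_apply_coord hk, generator_apply_coord hk, PiLp.add_apply, mul_add, ← mul_assoc,
    ← Int.cast_mul, entry_mul_self]
  by_cases hi : i = 0
  · subst hi
    simp [entry, hk]
    ring
  · simp [hi]

theorem generator_add (k : ℕ) (x v : E 9) :
    generator k (x + v) = generator k x + diagSign k v := by
  rw [isom_apply, isom_apply (generator k) x, linearPart_generator, map_add]
  abel

theorem contDiff_generator (k : ℕ) : ContDiff ℝ ∞ (generator k) := by
  have h : (generator k : E 9 → E 9) = fun x =>
      (diagSign k).toContinuousLinearEquiv x + generator k 0 :=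
    funext fun x => by rw [isom_apply, linearPart_generator]; rfl
  rw [h]
  exact (diagSign k).toContinuousLinearEquiv.contDiff.add contDiff_const

theorem Periodic.comp_generator (k : ℕ) {f : E 9 → F} (hf : Periodic f) :
    Periodic fun x => f (generator k x) := by
  intro i x
  change f (generator k (x + stdVec i)) = f (generator k x)
  rw [generator_add]
  exact hf.add_mem (diagSign_mem (single_one_mem i)) _

theorem partialD_comp_generator (k : ℕ) (i : Fin 9) {f : E 9 → F} (hf : ContDiff ℝ ∞ f) :
    partialD i (fun x => f (generator k x)) =
      fun x => (entry k i : ℝ) • partialD i f (generator k x) := by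
  funext x
  have h1 := (hf.differentiable (by simp) (generator k x)).hasFDerivAt
  have h2 := ((contDiff_generator k).differentiable (by simp) x).hasFDerivAt
  have h3 := (h1.comp x h2).fderiv
  rw [fderiv_isom, linearPart_generator] at h3
  refine (congrArg (fun T => T (stdVec i)) h3).trans ?_
  change fderiv ℝ f (generator k x) (diagSign k (stdVec i)) = _
  rw [diagSign_stdVec, map_smul]
  rfl

/-- Each ∂ᵢ picks up a diagonal entry ±1, and two derivatives in the same direction cancel it. -/
theorem laplacian_comp_generator (k : ℕ) {f : E 9 → F} (hf : ContDiff ℝ ∞ f) :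
    laplacian (fun x => f (generator k x)) = fun x => laplacian f (generator k x) := by
  funext x
  have h : ∀ i, partialD i (partialD i fun x => f (generator k x)) x =
      partialD i (partialD i f) (generator k x) := by
    intro i
    rw [partialD_comp_generator k i hf]
    have h1 := partialD_clm ((entry k i : ℝ) • ContinuousLinearMap.id ℝ F)
      ((contDiff_partialD i hf).comp (contDiff_generator k)) i
    refine (congrFun h1 x).trans ?_
    have h2 := congrFun (partialD_comp_generator k i (contDiff_partialD i hf)) x
    change (entry k i : ℝ) • partialD i (fun x => partialD i f (generator k x)) x = _
    rw [h2, smul_smul, ← Int.cast_mul, entry_mul_self, Int.cast_one, one_smul]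
  simp only [laplacian, h]

theorem comp_generator_mem (k : ℕ) {t : ℝ} {f : E 9 → ℂ} (hf : f ∈ periodicEigenspace 9 t) :
    (fun x => f (generator k x)) ∈ periodicEigenspace 9 t := by
  obtain ⟨h1, h2, h3⟩ := hf
  refine ⟨h1.comp (contDiff_generator k), h2.comp_generator k, ?_⟩
  rw [laplacian_comp_generator k h1, h3]
  rfl

/-- Decomposition of periodic eigenfunctions into even and odd ones for the generator. -/
noncomputable def periodicEigenspaceEquiv {k : ℕ} (hk : 0 < k) (t : ℝ) :
    periodicEigenspace 9 t ≃ₗ[ℂ] scalarSpace k 1 t × scalarSpace k (-1) t where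
  toFun f :=
    (⟨(1 / 2 : ℂ) • (f.1 + fun x => f.1 (generator k x)),
      Submodule.smul_mem _ _ (add_mem f.2 (comp_generator_mem k f.2)), fun x => by
        simp only [Pi.smul_apply, Pi.add_apply, generator_generator hk, f.2.2.1 0 x, smul_eq_mul]
        push_cast; ring⟩,
     ⟨(1 / 2 : ℂ) • (f.1 - fun x => f.1 (generator k x)),
      Submodule.smul_mem _ _ (sub_mem f.2 (comp_generator_mem k f.2)), fun x => by
        simp only [Pi.smul_apply, Pi.sub_apply, generator_generator hk, f.2.2.1 0 x, smul_eq_mul]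
        push_cast; ring⟩)
  map_add' f g := by
    ext x <;> simp <;> ring
  map_smul' c f := by
    ext x <;> simp <;> ring
  invFun q := ⟨q.1.1 + q.2.1, add_mem q.1.2.1 q.2.2.1⟩
  left_inv f := by
    ext x
    simp
    ring
  right_inv q := by
    have h1 := q.1.2.2
    have h2 := q.2.2.2
    ext x <;> simp [h1, h2] <;> ring

/-- The left side does not mention `k`: this is what allows two different groups to be compared at
every eigenvalue at once. -/
theorem rank_periodicEigenspace {k : ℕ} (hk : 0 < k) (t : ℝ) :
    Module.rank ℂ (periodicEigenspace 9 t) =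
      Module.rank ℂ (scalarSpace k 1 t) + Module.rank ℂ (scalarSpace k (-1) t) := by
  rw [(periodicEigenspaceEquiv hk t).rank_eq, rank_prod']

/-- If `periodicEigenspace` has a basis on which the generator acts diagonally by signs, then the
dimension of `scalarSpace` is the number of occurrences of the sign. -/
theorem rank_scalarSpace_of_basis {k : ℕ} {t : ℝ} {ι : Type} [Fintype ι] {u : ι → E 9 → ℂ}
    (hli : LinearIndependent ℂ u) (σ : ι → ℤ) (hu : ∀ i, u i ∈ periodicEigenspace 9 t)
    (hσ : ∀ i x, u i (generator k x) = σ i * u i x)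
    (hspan : ∀ f ∈ periodicEigenspace 9 t, f ∈ Submodule.span ℂ (Set.range u)) (s : ℤ) :
    Module.rank ℂ (scalarSpace k s t) = (Fintype.card {i // σ i = s} : ℕ) := by
  have hW : scalarSpace k s t =
      Submodule.span ℂ (Set.range fun i : {i // σ i = s} => u i) := by
    apply le_antisymm
    · rintro f ⟨hf, hf'⟩
      obtain ⟨c, hc⟩ := (Submodule.mem_span_range_iff_exists_fun ℂ).1 (hspan f hf)
      -- Comparing f composed with the generator to s f, independence kills every coefficient whose
      -- sign is not `s`.
      have h1 : ∑ i, (c i * ((σ i : ℂ) - s)) • u i = 0 := by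
        funext x
        have h2 := hf' x
        rw [← hc] at h2
        simp only [Finset.sum_apply, Pi.smul_apply, hσ, smul_eq_mul, Finset.mul_sum] at h2
        rw [← sub_eq_zero, ← Finset.sum_sub_distrib] at h2
        simp only [Finset.sum_apply, Pi.smul_apply, smul_eq_mul, Pi.zero_apply]
        rw [← h2]
        exact Finset.sum_congr rfl fun i _ => by ring
      have h3 := Fintype.linearIndependent_iff.1 hli _ h1
      rw [← hc]
      refine Submodule.sum_mem _ fun i _ => ?_
      by_cases hi : σ i = s
      · exact Submodule.smul_mem _ _ (Submodule.subset_span ⟨⟨i, hi⟩, rfl⟩)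
      · have : c i = 0 := (mul_eq_zero.1 (h3 i)).resolve_right
          (sub_ne_zero.2 (by exact_mod_cast hi))
        rw [this, zero_smul]
        exact zero_mem _
    · rw [Submodule.span_le]
      rintro _ ⟨⟨i, rfl⟩, rfl⟩
      exact ⟨hu i, hσ i⟩
  have hli' : LinearIndependent ℂ fun i : {i // σ i = s} => u i :=
    hli.comp _ Subtype.val_injective
  rw [hW, rank_span hli', Cardinal.mk_range_eq _ hli'.injective, Cardinal.mk_fintype]

theorem chi_mem (a : Fin n → ℤ) {t : ℝ} (ht : 4 * Real.pi ^ 2 * ∑ i, (a i : ℝ) ^ 2 = t) :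
    chi a ∈ periodicEigenspace n t :=
  ⟨contDiff_chi a, periodic_chi a, by rw [laplacian_chi, ht]⟩

theorem eq_const_of_mem_periodicEigenspace_zero {f : E n → ℂ}
    (hf : f ∈ periodicEigenspace n 0) : ∃ c : ℂ, f = fun _ => c := by
  obtain ⟨h1, h2, h3⟩ := hf
  refine ⟨coeff 0 f, ?_⟩
  have := eq_sum_chi_of_laplacian h1 h2 h3 {0} fun a ha => by
    have hpi := Real.pi_pos.ne'
    have h4 : ∑ i, (a i : ℝ) ^ 2 = 0 := by
      simpa [hpi] using ha
    rw [Finset.sum_eq_zero_iff_of_nonneg fun i _ => sq_nonneg _] at h4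
    rw [Finset.mem_singleton]
    funext i
    have := h4 i (Finset.mem_univ i)
    simpa using this
  rw [Finset.sum_singleton] at this
  funext x
  conv_lhs => rw [this]
  simp [chi_zero]

theorem rank_scalarSpace_zero (k : ℕ) (s : ℤ) :
    Module.rank ℂ (scalarSpace k s 0) = (Fintype.card {_i : Unit // 1 = s} : ℕ) := by
  refine rank_scalarSpace_of_basis (u := fun _ : Unit => fun _ => (1 : ℂ)) ?_ (fun _ => 1)
    (fun _ => ⟨contDiff_const, fun _ _ => rfl, ?_⟩) (fun _ _ => by simp) (fun f hf => ?_) s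
  · rw [Fintype.linearIndependent_iff]
    intro c hc i
    simpa using congrFun hc 0
  · rw [laplacian_const]
    simp
  · obtain ⟨c, rfl⟩ := eq_const_of_mem_periodicEigenspace_zero hf
    have : (fun _ : E 9 => c) = c • fun _ => (1 : ℂ) := by
      funext x
      simp
    rw [this]
    exact Submodule.smul_mem _ _ (Submodule.subset_span ⟨(), rfl⟩)

end Scalar

end FlatForms

namespace FlatForms

open scoped ContDiff Topology

/-! ### The first non-zero eigenvalue -/

section FirstEigenvalue

theorem exists_eq_single_of_sum_sq_eq_one {n : ℕ} {a : Fin n → ℤ} (h : ∑ i, a i ^ 2 = 1) :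
    ∃ j, a = Pi.single j 1 ∨ a = Pi.single j (-1) := by
  obtain ⟨j, hj⟩ : ∃ j, a j ≠ 0 := by
    by_contra! h0
    simp [h0] at h
  have h1 := Finset.add_sum_erase Finset.univ (fun i => a i ^ 2) (Finset.mem_univ j)
  rw [h] at h1
  have h2 : 0 ≤ ∑ i ∈ Finset.univ.erase j, a i ^ 2 := Finset.sum_nonneg fun i _ => sq_nonneg _
  have h3 : 0 < a j ^ 2 := by positivity
  have h4 : a j ^ 2 = 1 := by linarith
  have h5 : ∑ i ∈ Finset.univ.erase j, a i ^ 2 = 0 := by linarith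
  rw [Finset.sum_eq_zero_iff_of_nonneg fun i _ => sq_nonneg _] at h5
  have h6 : ∀ c, a j = c → a = Pi.single j c := by
    intro c hc
    funext i
    by_cases hi : i = j
    · subst hi; simp [hc]
    · rw [Pi.single_eq_of_ne hi]
      exact pow_eq_zero_iff two_ne_zero |>.1 (h5 i (Finset.mem_erase.2 ⟨hi, Finset.mem_univ i⟩))
  rcases sq_eq_one_iff.1 h4 with h7 | h7
  · exact ⟨j, Or.inl (h6 _ h7)⟩
  · exact ⟨j, Or.inr (h6 _ h7)⟩

theorem chi_single (i : Fin 9) (m : ℤ) (x : E 9) :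
    chi (Pi.single i m) x = Complex.exp (2 * Real.pi * Complex.I * (m * x i)) := by
  rw [chi]
  congr 2
  rw [Finset.sum_eq_single i]
  · simp
  · intro j _ hj
    simp [hj]
  · simp

/-- The shift by 1/2 affects only the first coordinate, where it contributes exp(±πi) = -1; this is
why frequencies are restricted to ±1. -/
theorem chi_single_generator {k : ℕ} (hk : 0 < k) (i : Fin 9) (m : ℤ) (hm : m = 1 ∨ m = -1)
    (x : E 9) : chi (Pi.single i m) (generator k x) =
      (if i = 0 then -1 else 1) * chi (Pi.single i (entry k i * m)) x := by
  rw [chi_single, chi_single, generator_apply_coord hk]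
  split_ifs with hi
  · have h1 : Complex.exp (2 * Real.pi * Complex.I * (m * (1 / 2))) = -1 := by
      rcases hm with rfl | rfl
      · rw [← Complex.exp_pi_mul_I]
        congr 1
        push_cast; ring
      · rw [← inv_neg_one, ← Complex.exp_pi_mul_I, ← Complex.exp_neg]
        congr 1
        push_cast; ring
    rw [← h1, ← Complex.exp_add]
    congr 1
    push_cast
    ring
  · rw [one_mul]
    congr 1
    push_cast
    ring

/-- The sign `1` or `-1` attached to a Boolean. -/
def boolSign (b : Bool) : ℤ := if b then -1 else 1

/-- The functions `2 cos(2π xⱼ)` and `2i sin(2π xⱼ)`. -/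
noncomputable def trig (q : Fin 9 × Bool) : E 9 → ℂ :=
  chi (Pi.single q.1 1) + (boolSign q.2 : ℂ) • chi (Pi.single q.1 (-1))

/-- The sign by which the generator of `diagGroup k` acts on `trig`. -/
def trigSign (k : ℕ) (q : Fin 9 × Bool) : ℤ :=
  (if q.1 = 0 then -1 else 1) * if (q.1 : ℕ) < k then 1 else boolSign q.2

theorem boolSign_mul_self (b : Bool) : boolSign b * boolSign b = 1 := by
  cases b <;> rfl

theorem trig_generator {k : ℕ} (hk : 0 < k) (q : Fin 9 × Bool) (x : E 9) :
    trig q (generator k x) = trigSign k q * trig q x := by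
  obtain ⟨i, b⟩ := q
  have hb : (boolSign b : ℂ) * boolSign b = 1 := by exact_mod_cast boolSign_mul_self b
  simp only [trig, trigSign, Pi.add_apply, Pi.smul_apply, smul_eq_mul,
    chi_single_generator hk i 1 (Or.inl rfl), chi_single_generator hk i (-1) (Or.inr rfl), entry]
  by_cases hik : (i : ℕ) < k
  · simp only [hik, if_true, one_mul, mul_one]
    push_cast
    ring
  · simp only [hik, if_false, mul_one, neg_mul, one_mul, neg_neg]
    push_cast
    linear_combination (-(if i = 0 then -1 else 1 : ℂ) * chi (Pi.single i (-1)) x) * hb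

theorem sum_single_sq (i : Fin 9) {m : ℤ} (hm : m = 1 ∨ m = -1) :
    4 * Real.pi ^ 2 * ∑ j, (((Pi.single i m : Fin 9 → ℤ) j : ℤ) : ℝ) ^ 2 =
      4 * Real.pi ^ 2 * 1 := by
  rw [Finset.sum_eq_single i]
  · rcases hm with rfl | rfl <;> simp
  · intro j _ hj
    simp [hj]
  · simp

theorem chi_single_mem (i : Fin 9) {m : ℤ} (hm : m = 1 ∨ m = -1) :
    chi (Pi.single i m) ∈ periodicEigenspace 9 (4 * Real.pi ^ 2 * 1) :=
  chi_mem _ (sum_single_sq i hm)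

theorem coeff_trig (i : Fin 9) {m : ℤ} (q : Fin 9 × Bool) (hm : m = 1 ∨ m = -1) :
    coeff (Pi.single i m) (trig q) =
      if q.1 = i then (if m = 1 then 1 else (boolSign q.2 : ℂ)) else 0 := by
  rw [trig, coeff_add _ (contDiff_chi _) (contDiff_smul_pi _ (contDiff_chi _)),
    show (boolSign q.2 : ℂ) • chi (Pi.single q.1 (-1)) = fun x =>
      (boolSign q.2 : ℂ) * (chi (Pi.single q.1 (-1)) : E 9 → ℂ) x from rfl,
    coeff_const_mul _ _ (contDiff_chi _), coeff_chi, coeff_chi]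
  have h : ∀ m' : ℤ, m ≠ 0 → ((Pi.single i m : Fin 9 → ℤ) = Pi.single q.1 m' ↔
      q.1 = i ∧ m = m') := by
    intro m' h0
    constructor
    · intro h1
      have h2 := congrFun h1 i
      rw [Pi.single_eq_same] at h2
      by_cases hqi : q.1 = i
      · refine ⟨hqi, ?_⟩
        rwa [hqi, Pi.single_eq_same] at h2
      · rw [Pi.single_eq_of_ne (Ne.symm hqi)] at h2
        exact absurd h2 h0
    · rintro ⟨h1, h2⟩
      rw [h1, h2]
  rcases hm with rfl | rfl <;> by_cases hqi : q.1 = i <;> simp [h, hqi]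

theorem linearIndependent_trig : LinearIndependent ℂ trig := by
  have hsm : ∀ q, ContDiff ℝ ∞ (trig q) := fun q =>
    (contDiff_chi _).add (contDiff_smul_pi _ (contDiff_chi _))
  rw [Fintype.linearIndependent_iff]
  intro c hc
  -- The Fourier coefficients at eᵢ and -eᵢ give the sum and the difference of the two unknowns for
  -- coordinate i.
  have key : ∀ (i : Fin 9) (m : ℤ), (m = 1 ∨ m = -1) →
      c (i, false) * (if m = 1 then 1 else 1) + c (i, true) * (if m = 1 then 1 else -1) = 0 := by
    intro i m hm
    have h1 := congrArg (coeff (Pi.single i m)) hc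
    rw [coeff_sum _ _ (fun q => contDiff_smul_pi _ (hsm q)), coeff_zero] at h1
    have h2 : ∀ q, coeff (Pi.single i m) (c q • trig q) = c q *
        if q.1 = i then (if m = 1 then 1 else (boolSign q.2 : ℂ)) else 0 := fun q => by
      rw [← coeff_trig i q hm]
      exact coeff_const_mul _ _ (hsm q)
    simp only [h2] at h1
    rw [Fintype.sum_prod_type, Finset.sum_eq_single i] at h1
    · rw [Fintype.sum_bool] at h1
      simp only [if_true, boolSign] at h1
      rw [← h1]
      rcases hm with rfl | rfl <;> simp [add_comm]
    · intro j _ hj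
      simp [hj]
    · simp
  rintro ⟨i, b⟩
  have h1 := key i 1 (Or.inl rfl)
  have h2 := key i (-1) (Or.inr rfl)
  have hne : ¬ ((-1 : ℤ) = 1) := by decide
  simp only [if_true, hne, if_false] at h1 h2
  cases b
  · linear_combination (h1 + h2) / 2
  · linear_combination (h1 - h2) / 2

theorem mem_span_trig {f : E 9 → ℂ} (hf : f ∈ periodicEigenspace 9 (4 * Real.pi ^ 2 * 1)) :
    f ∈ Submodule.span ℂ (Set.range trig) := by
  classical
  obtain ⟨h1, h2, h3⟩ := hf
  let S : Finset (Fin 9 → ℤ) := Finset.univ.image (fun j => Pi.single j 1) ∪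
    Finset.univ.image (fun j => Pi.single j (-1))
  have hS := eq_sum_chi_of_laplacian h1 h2 h3 S fun a ha => by
    have hpi := Real.pi_pos.ne'
    have h4 : ∑ i, (a i : ℝ) ^ 2 = 1 := mul_left_cancel₀ (by positivity) ha
    obtain ⟨j, hj⟩ := exists_eq_single_of_sum_sq_eq_one (a := a) (by exact_mod_cast h4)
    rw [Finset.mem_union, Finset.mem_image, Finset.mem_image]
    exact hj.imp (fun h => ⟨j, Finset.mem_univ j, h.symm⟩) fun h => ⟨j, Finset.mem_univ j, h.symm⟩
  have hplus : ∀ j, chi (Pi.single j 1) ∈ Submodule.span ℂ (Set.range trig) := by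
    intro j
    have h4 : (chi (Pi.single j 1) : E 9 → ℂ) =
        (1 / 2 : ℂ) • (trig (j, false) + trig (j, true)) := by
      funext x
      simp [trig, boolSign]
      ring
    rw [h4]
    exact Submodule.smul_mem _ _ (add_mem (Submodule.subset_span ⟨_, rfl⟩)
      (Submodule.subset_span ⟨_, rfl⟩))
  have hminus : ∀ j, chi (Pi.single j (-1)) ∈ Submodule.span ℂ (Set.range trig) := by
    intro j
    have h4 : (chi (Pi.single j (-1)) : E 9 → ℂ) =
        (1 / 2 : ℂ) • (trig (j, false) - trig (j, true)) := by
      funext x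
      simp [trig, boolSign]
      ring
    rw [h4]
    exact Submodule.smul_mem _ _ (sub_mem (Submodule.subset_span ⟨_, rfl⟩)
      (Submodule.subset_span ⟨_, rfl⟩))
  rw [hS]
  refine Submodule.sum_mem _ fun a ha => Submodule.smul_mem _ _ ?_
  rw [Finset.mem_union, Finset.mem_image, Finset.mem_image] at ha
  rcases ha with ⟨j, _, rfl⟩ | ⟨j, _, rfl⟩
  · exact hplus j
  · exact hminus j

theorem rank_scalarSpace_one {k : ℕ} (hk : 0 < k) (s : ℤ) :
    Module.rank ℂ (scalarSpace k s (4 * Real.pi ^ 2 * 1)) =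
      (Fintype.card {q // trigSign k q = s} : ℕ) :=
  rank_scalarSpace_of_basis linearIndependent_trig (trigSign k)
    (fun q => add_mem (chi_single_mem q.1 (Or.inl rfl))
      (Submodule.smul_mem _ _ (chi_single_mem q.1 (Or.inr rfl))))
    (trig_generator hk) (fun _ hf => mem_span_trig hf) s

end FirstEigenvalue

end FlatForms

namespace FlatForms

open scoped ContDiff Topology

/-! ### Spectra on forms -/

section Spectrum

variable {p : ℕ}

/-- Invariance decouples over I because the linear part is diagonal; the sign may be moved across
since it squares to 1. -/
theorem pullback_generator_eq_iff {k : ℕ} {α : Form ℂ 9 p} :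
    pullback (generator k) α = α ↔ ∀ (I : Set.powersetCard (Fin 9) p) x,
      coefficient I α (generator k x) = formSign k I * coefficient I α x := by
  have hsq : ∀ I : Finset (Fin 9), (formSign k I : ℂ) * formSign k I = 1 := fun I => by
    exact_mod_cast formSign_mul_self k I
  have hpt : ∀ (I : Set.powersetCard (Fin 9) p) x,
      pullback (generator k) α x (basisTuple I) =
        (formSign k I : ℂ) * coefficient I α (generator k x) := by
    intro I x
    rw [pullback_generator_basisTuple, Complex.real_smul, Complex.ofReal_intCast]
    rfl
  constructor
  · intro h I x
    have h1 := hpt I x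
    rw [h] at h1
    change coefficient I α x = _ at h1
    rw [h1, ← mul_assoc, hsq, one_mul]
  · intro h
    funext x
    refine alternating_ext fun I => ?_
    rw [hpt, h, ← mul_assoc, hsq, one_mul]
    rfl

theorem mem_eigenspace_iff {k : ℕ} {t : ℝ} {α : Form ℂ 9 p} :
    α ∈ eigenspace (diagGroup k) p t ↔
      ContDiff ℝ ∞ α ∧ ∀ I, coefficient I α ∈ scalarSpace k (formSign k I.1) t := by
  have hlap : ContDiff ℝ ∞ α → (hodgeLaplacian α = (t : ℂ) • α ↔
      ∀ I, laplacian (coefficient I α) = (t : ℂ) • coefficient I α) := by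
    intro h1
    constructor
    · intro h2 I
      rw [← coefficient_hodgeLaplacian I h1, h2]
      rfl
    · intro h2
      refine form_ext fun I => ?_
      rw [coefficient_hodgeLaplacian I h1, h2]
      rfl
  constructor
  · rintro ⟨h, h4⟩
    obtain ⟨h1, h2, h3⟩ := mem_smoothForms_diagGroup.1 h
    exact ⟨h1, fun I => ⟨⟨contDiff_coefficient I h1, periodic_iff_coefficient.1 h2 I,
      (hlap h1).1 h4 I⟩, pullback_generator_eq_iff.1 h3 I⟩⟩
  · rintro ⟨h1, h⟩
    exact ⟨mem_smoothForms_diagGroup.2 ⟨h1, periodic_iff_coefficient.2 fun I => (h I).1.2.1,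
      pullback_generator_eq_iff.2 fun I => (h I).2⟩, (hlap h1).2 fun I => (h I).1.2.2⟩

/-- Eigenforms are given by their coefficients. -/
noncomputable def eigenspaceEquiv (k p : ℕ) (t : ℝ) :
    eigenspace (diagGroup k) p t ≃ₗ[ℂ]
      ∀ I : Set.powersetCard (Fin 9) p, scalarSpace k (formSign k I.1) t where
  toFun α I := ⟨coefficient I α.1, (mem_eigenspace_iff.1 α.2).2 I⟩
  map_add' _ _ := rfl
  map_smul' _ _ := rfl
  invFun f := ⟨ofCoefficients fun I => (f I).1, mem_eigenspace_iff.2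
    ⟨contDiff_ofCoefficients fun I => (f I).2.1.1, fun I => by
      rw [coefficient_ofCoefficients]
      exact (f I).2⟩⟩
  left_inv α := Subtype.ext (form_ext fun I => coefficient_ofCoefficients _ I)
  right_inv f := funext fun I => Subtype.ext (coefficient_ofCoefficients _ I)

/-- The number of `p`-element index sets on whose form `diagSign k` acts by the sign `s`. -/
def signCount (k p : ℕ) (s : ℤ) : ℕ :=
  ((Finset.powersetCard p Finset.univ).filter fun I => formSign k I = s).card

theorem formSign_eq (k : ℕ) (I : Finset (Fin 9)) : formSign k I = 1 ∨ formSign k I = -1 := by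
  have := formSign_mul_self k I
  exact mul_self_eq_one_iff.1 this

/-- `rank_pi` yields a `Cardinal.sum`, while sorting the index sets by sign needs a finite sum.
Representing cardinals by types turns the claim into one about sigma types, proved by adjoining one
index at a time. -/
theorem cardinal_sum_fintype {ι : Type} [Fintype ι] (f : ι → Cardinal.{0}) :
    Cardinal.sum f = ∑ i, f i := by
  classical
  have key : ∀ (ι : Type) [Fintype ι], ∀ X : ι → Type,
      Cardinal.mk (Σ i, X i) = ∑ i, Cardinal.mk (X i) := by
    intro ι _
    refine Fintype.induction_empty_option
      (P := fun ι _ => ∀ X : ι → Type, Cardinal.mk (Σ i, X i) = ∑ i, Cardinal.mk (X i)) ?_ ?_ ?_ ι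
    · intro α β _ e h X
      let _ : Fintype α := Fintype.ofEquiv β e.symm
      rw [← e.sum_comp fun i => Cardinal.mk (X i), ← h fun i => X (e i)]
      exact Cardinal.mk_congr (Equiv.sigmaCongrLeft e).symm
    · intro X
      simp
    · intro α _ h X
      rw [Fintype.sum_option, ← h fun i => X (some i), Cardinal.add_def]
      exact Cardinal.mk_congr
        { toFun := fun q => match q with
            | ⟨none, x⟩ => Sum.inl x
            | ⟨some i, x⟩ => Sum.inr ⟨i, x⟩
          invFun := fun q => match q with
            | Sum.inl x => ⟨none, x⟩
            | Sum.inr ⟨i, x⟩ => ⟨some i, x⟩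
          left_inv := by rintro ⟨_ | i, x⟩ <;> rfl
          right_inv := by rintro (x | ⟨i, x⟩) <;> rfl }
  have h := key ι fun i => (f i).out
  rw [Cardinal.mk_sigma] at h
  simpa only [Cardinal.mk_out] using h

theorem sum_powersetCard (p : ℕ) (f : Finset (Fin 9) → Cardinal.{0}) :
    Cardinal.sum (fun I : Set.powersetCard (Fin 9) p => f I.1) =
      ∑ I ∈ Finset.powersetCard p Finset.univ, f I := by
  rw [cardinal_sum_fintype]
  exact (Finset.sum_subtype _ (fun I => by simp) f).symm

/-- The space of eigenforms is a product of scalar spaces that depend on I only through its sign, so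
the factors are grouped by sign. -/
theorem multiplicity_eq (k p : ℕ) (t : ℝ) :
    multiplicity (diagGroup k) p t =
      signCount k p 1 * Module.rank ℂ (scalarSpace k 1 t) +
        signCount k p (-1) * Module.rank ℂ (scalarSpace k (-1) t) := by
  rw [multiplicity, (eigenspaceEquiv k p t).rank_eq, rank_pi,
    sum_powersetCard p fun I => Module.rank ℂ (scalarSpace k (formSign k I) t),
    ← Finset.sum_filter_add_sum_filter_not _ fun I => formSign k I = 1]
  congr 1
  · rw [Finset.sum_congr rfl fun I hI => by rw [(Finset.mem_filter.1 hI).2], Finset.sum_const,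
      nsmul_eq_mul]
    rfl
  · have h : ∀ I : Finset (Fin 9), ¬ formSign k I = 1 ↔ formSign k I = -1 := fun I => by
      rcases formSign_eq k I with h | h <;> simp [h]
    simp only [h]
    rw [Finset.sum_congr rfl fun I hI => by rw [(Finset.mem_filter.1 hI).2], Finset.sum_const,
      nsmul_eq_mul]
    rfl

theorem multiplicity_zero (k p : ℕ) :
    multiplicity (diagGroup k) p 0 = (signCount k p 1 : ℕ) := by
  rw [multiplicity_eq, rank_scalarSpace_zero, rank_scalarSpace_zero,
    show Fintype.card {_i : Unit // (1 : ℤ) = 1} = 1 from rfl,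
    show Fintype.card {_i : Unit // (1 : ℤ) = -1} = 0 from rfl]
  simp

theorem multiplicity_one {k : ℕ} (hk : 0 < k) (p : ℕ) :
    d (diagGroup k) p 1 =
      ((signCount k p 1 * Fintype.card {q // trigSign k q = 1} +
        signCount k p (-1) * Fintype.card {q // trigSign k q = -1} : ℕ) : Cardinal) := by
  rw [d, multiplicity_eq, rank_scalarSpace_one hk, rank_scalarSpace_one hk]
  push_cast
  rfl

/-- If half of the signs are positive for both groups, then they are `p`-isospectral. -/
theorem pIsospectral_of_signCount {k k' p : ℕ} (hk : 0 < k) (hk' : 0 < k')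
    (h : signCount k p 1 = signCount k p (-1)) (h' : signCount k' p 1 = signCount k' p (-1))
    (hkk' : signCount k p 1 = signCount k' p 1) :
    PIsospectral p (diagGroup k) (diagGroup k') := fun t => by
  -- With equal counts the common factor comes out, leaving the total dimension of the even and odd
  -- parts, which is that of the torus for both groups.
  rw [multiplicity_eq, multiplicity_eq, ← h, ← h', ← hkk', ← mul_add, ← mul_add,
    ← rank_periodicEigenspace hk, ← rank_periodicEigenspace hk']

end Spectrum

/-! ### De Rham cohomology -/

section DeRham

variable {p : ℕ}

theorem contDiff_pullback {n : ℕ} (γ : Isom n) {α : Form ℂ n p} (hα : ContDiff ℝ ∞ α)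
    (hγ : ContDiff ℝ ∞ γ) : ContDiff ℝ ∞ (pullback γ α) := by
  have h : pullback γ α = fun x => ContinuousAlternatingMap.compContinuousLinearMapCLM
      ((linearPart n γ).toContinuousLinearEquiv : E n →L[ℝ] E n) (α (γ x)) := by
    funext x
    rw [pullback, fderiv_isom]
    rfl
  rw [h]
  exact (ContinuousLinearMap.contDiff _).comp (hα.comp hγ)

theorem extDeriv_pullback_generator (k : ℕ) {α : Form ℂ 9 p} (hα : ContDiff ℝ ∞ α) :
    extDeriv (pullback (generator k) α) = pullback (generator k) (extDeriv α) :=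
  funext fun x => extDeriv_pullback (hα.differentiable (by simp) _)
    (contDiff_generator k).contDiffAt (by
      rw [minSmoothness_of_isRCLikeNormedField]
      exact WithTop.coe_le_coe.2 (le_top : (2 : ℕ∞) ≤ ⊤))

theorem Periodic.pullback_generator (k : ℕ) {α : Form ℂ 9 p} (hα : Periodic α) :
    Periodic (pullback (generator k) α) := by
  intro i x
  ext v
  rw [pullback_apply, pullback_apply]
  congr 1
  exact hα.comp_generator k i x

theorem pullback_pullback_generator {k : ℕ} (hk : 0 < k) {α : Form ℂ 9 p} (hα : Periodic α) :
    pullback (generator k) (pullback (generator k) α) = α := by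
  have h : generator k * generator k = translation (stdVec 0) := by
    ext1 x
    rw [translation_apply, add_comm]
    exact generator_generator hk x
  rw [← pullback_mul, h, pullback_translation]
  exact funext (hα 0)

/-- The symmetrization of a periodic form is invariant. -/
theorem symmetrization_mem {k : ℕ} (hk : 0 < k) {β : Form ℂ 9 p} (hβ : ContDiff ℝ ∞ β)
    (hp : Periodic β) :
    (1 / 2 : ℂ) • (β + pullback (generator k) β) ∈ smoothForms ℂ (diagGroup k) p := by
  have h1 : ContDiff ℝ ∞ (pullback (generator k) β) :=
    contDiff_pullback _ hβ (contDiff_generator k)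
  have h2 := hp.pullback_generator k
  have h3 : ContDiff ℝ ∞ ((1 / 2 : ℂ) • (β + pullback (generator k) β)) :=
    (hβ.add h1).const_smul (1 / 2 : ℂ)
  refine mem_smoothForms_diagGroup.2 ⟨h3, fun i x => ?_, ?_⟩
  · rw [Pi.smul_apply, Pi.smul_apply, Pi.add_apply, Pi.add_apply, hp, h2]
  · have h4 : pullback (generator k) ((1 / 2 : ℂ) • (β + pullback (generator k) β)) =
        (1 / 2 : ℂ) • (pullback (generator k) β +
          pullback (generator k) (pullback (generator k) β)) := rfl
    rw [h4, pullback_pullback_generator hk hp, add_comm]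

theorem extDeriv_symmetrization (k : ℕ) {β : Form ℂ 9 p} (hβ : ContDiff ℝ ∞ β) :
    extDeriv ((1 / 2 : ℂ) • (β + pullback (generator k) β)) =
      (1 / 2 : ℂ) • (extDeriv β + pullback (generator k) (extDeriv β)) := by
  have h1 : ContDiff ℝ ∞ (pullback (generator k) β) :=
    contDiff_pullback _ hβ (contDiff_generator k)
  have h2 : ContDiff ℝ ∞ (β + pullback (generator k) β) := hβ.add h1
  rw [extDeriv_smul_smooth _ h2, extDeriv_add_smooth hβ h1, extDeriv_pullback_generator k hβ]

theorem exists_eq_const_of_mem_eigenspace_zero {k : ℕ} {α : Form ℂ 9 p}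
    (h : α ∈ eigenspace (diagGroup k) p 0) : ∃ c, α = fun _ => c := by
  refine ⟨α 0, funext fun x => alternating_ext fun I => ?_⟩
  obtain ⟨c, hc⟩ := eq_const_of_mem_periodicEigenspace_zero ((mem_eigenspace_iff.1 h).2 I).1
  exact (congrFun hc x).trans (congrFun hc 0).symm

theorem extDeriv_const {n : ℕ} (c : Alt n p) : extDeriv (fun _ : E n => c) = 0 := by
  funext x
  have h1 := map_zero (ContinuousAlternatingMap.alternatizeUncurryFinCLM ℝ (E n) ℂ (n := p))
  rw [extDeriv, fderiv_fun_const]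
  exact h1

theorem eigenspace_zero_le_closedForms (k p : ℕ) :
    eigenspace (diagGroup k) p 0 ≤ closedForms (diagGroup k) p := by
  intro α hα
  refine ⟨hα.1, ?_⟩
  obtain ⟨c, rfl⟩ := exists_eq_const_of_mem_eigenspace_zero hα
  exact extDeriv_const c

theorem torusExact_of_mem_exactForms {k : ℕ} {α : Form ℂ 9 p}
    (h : α ∈ exactForms (diagGroup k) p) : TorusExact α := by
  cases p with
  | zero => exact h
  | succ p =>
    obtain ⟨⟨β, hβ⟩, rfl⟩ := h
    obtain ⟨h1, h2, -⟩ := mem_smoothForms_diagGroup.1 hβ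
    exact ⟨β, h1, h2, rfl⟩

/-- Symmetrization commutes with d, so a primitive on the torus is averaged into an invariant
primitive. -/
theorem symmetrization_mem_exactForms {k : ℕ} (hk : 0 < k) {α : Form ℂ 9 p} (h : TorusExact α) :
    (1 / 2 : ℂ) • (α + pullback (generator k) α) ∈ exactForms (diagGroup k) p := by
  cases p with
  | zero =>
    rw [TorusExact] at h
    subst h
    refine (Submodule.mem_bot ℂ).2 ?_
    funext x
    ext v
    simp [pullback_apply]
  | succ p =>
    obtain ⟨β, h1, h2, rfl⟩ := h
    exact ⟨⟨_, symmetrization_mem hk h1 h2⟩, extDeriv_symmetrization k h1⟩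

theorem const_mem_eigenspace_zero {k : ℕ} {c : Alt 9 p}
    (h : (fun _ => c) ∈ smoothForms ℂ (diagGroup k) p) :
    (fun _ => c) ∈ eigenspace (diagGroup k) p 0 := by
  refine ⟨h, ?_⟩
  rw [hodgeLaplacian_eq contDiff_const, laplacian_const, Complex.ofReal_zero, zero_smul]

/-- The Hodge theorem: cohomology is represented by harmonic forms. -/
theorem betti_eq {k : ℕ} (hk : 0 < k) (p : ℕ) :
    betti (diagGroup k) p = multiplicity (diagGroup k) p 0 := by
  let N := (exactForms (diagGroup k) p).submoduleOf (closedForms (diagGroup k) p)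
  let Φ : eigenspace (diagGroup k) p 0 →ₗ[ℂ] closedForms (diagGroup k) p ⧸ N :=
    N.mkQ.comp (Submodule.inclusion (eigenspace_zero_le_closedForms k p))
  have hinj : Function.Injective Φ := by
    rw [← LinearMap.ker_eq_bot, LinearMap.ker_eq_bot']
    intro α hα
    have h1 := (Submodule.Quotient.mk_eq_zero N).1 hα
    have h2 : α.1 ∈ exactForms (diagGroup k) p := h1
    have h3 := torusExact_of_mem_exactForms h2
    obtain ⟨c, hc⟩ := exists_eq_const_of_mem_eigenspace_zero α.2
    -- A harmonic form is constant; if it is exact, its mean, which is itself, vanishes.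
    rw [hc] at h3
    apply Subtype.ext
    rw [hc, eq_zero_of_torusExact_const h3]
    rfl
  have hsurj : Function.Surjective Φ := by
    intro q
    obtain ⟨⟨α, hα, hcl⟩, rfl⟩ := Submodule.Quotient.mk_surjective N q
    obtain ⟨h1, h2, h3⟩ := mem_smoothForms_diagGroup.1 hα
    -- The harmonic representative of α is the symmetrized mean. As α equals its own symmetrization,
    -- the difference is the symmetrization of the torus-exact form α - m.
    let m : Form ℂ 9 p := fun _ => meanValue α
    have hm := symmetrization_mem (β := m) hk contDiff_const fun _ _ => rfl
    have hconst : (1 / 2 : ℂ) • (m + pullback (generator k) m) =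
        fun _ => ((1 / 2 : ℂ) • (m + pullback (generator k) m)) 0 := by
      funext x
      ext v
      simp only [Pi.smul_apply, Pi.add_apply, ContinuousAlternatingMap.smul_apply,
        ContinuousAlternatingMap.add_apply, pullback_apply]
      rfl
    have he : (1 / 2 : ℂ) • (m + pullback (generator k) m) ∈ eigenspace (diagGroup k) p 0 := by
      rw [hconst] at hm ⊢
      exact const_mem_eigenspace_zero hm
    refine ⟨⟨_, he⟩, ?_⟩
    have hex := symmetrization_mem_exactForms hk (torusExact_sub_meanValue h1 h2 hcl)
    have hdiff : (1 / 2 : ℂ) • ((α - m) + pullback (generator k) (α - m)) =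
        α - (1 / 2 : ℂ) • (m + pullback (generator k) m) := by
      have h4 : pullback (generator k) (α - m) =
          pullback (generator k) α - pullback (generator k) m := rfl
      rw [h4, h3]
      module
    refine ((Submodule.Quotient.eq N).2 ?_).symm
    change α - (1 / 2 : ℂ) • (m + pullback (generator k) m) ∈ exactForms (diagGroup k) p
    rw [← hdiff]
    exact hex
  exact ((LinearEquiv.ofBijective Φ ⟨hinj, hsurj⟩).rank_eq).symm

theorem betti_diagGroup {k : ℕ} (hk : 0 < k) (p : ℕ) :
    betti (diagGroup k) p = (signCount k p 1 : ℕ) := by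
  rw [betti_eq hk, multiplicity_zero]

end DeRham

end FlatForms

namespace FlatForms

/-! ### Numerical values -/

section Values

theorem signCount_three_one : ∀ p : Fin 10, signCount 3 p 1 =
    ![1, 3, 18, 46, 60, 60, 46, 18, 3, 1] p := by
  decide +kernel

theorem signCount_six_one : ∀ p : Fin 10, signCount 6 p 1 =
    ![1, 6, 18, 38, 60, 66, 46, 18, 3, 0] p := by
  decide +kernel

theorem signCount_three_neg_one : ∀ p : Fin 10, signCount 3 p (-1) =
    ![0, 6, 18, 38, 66, 66, 38, 18, 6, 0] p := by
  decide +kernel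

theorem signCount_six_neg_one : ∀ p : Fin 10, signCount 6 p (-1) =
    ![0, 3, 18, 46, 66, 60, 38, 18, 6, 1] p := by
  decide +kernel

/-- Of the 18 trigonometric functions, the first coordinate gives two odd ones (half shift), the two
other fixed coordinates give four even ones, and each of the six reflected coordinates gives one of
each: 10 even and 8 odd. -/
theorem d_one_three (p : Fin 10) :
    d Γ₁ p 1 = ((![10, 78, 324, 764, 1128, 1128, 764, 324, 78, 10] p : ℕ) : Cardinal) := by
  rw [Γ₁, multiplicity_one (by norm_num), signCount_three_one, signCount_three_neg_one,
    show Fintype.card {q // trigSign 3 q = 1} = 10 by decide +kernel,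
    show Fintype.card {q // trigSign 3 q = -1} = 8 by decide +kernel]
  congr 1
  revert p
  decide +kernel

/-- The same count with five further fixed coordinates and three reflected ones: 13 even and 5 odd.
-/
theorem d_one_six (p : Fin 10) :
    d Γ₂ p 1 = ((![13, 93, 324, 724, 1110, 1158, 788, 324, 69, 5] p : ℕ) : Cardinal) := by
  rw [Γ₂, multiplicity_one (by norm_num), signCount_six_one, signCount_six_neg_one,
    show Fintype.card {q // trigSign 6 q = 1} = 13 by decide +kernel,
    show Fintype.card {q // trigSign 6 q = -1} = 5 by decide +kernel]
  congr 1
  revert p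
  decide +kernel

theorem krawtchouk_ne_zero : ∀ n < 9, Odd n → ∀ l ≤ n, ∀ j ≤ n, krawtchouk l n j ≠ 0 := by
  decide +kernel

/-- Finite evaluation. The zeros with l = 2, 7 and j = 3, 6 are the vanishing traces behind the
isospectrality. -/
theorem krawtchouk_nine_eq_zero_iff : ∀ l ≤ 9, ∀ j ≤ 9, (krawtchouk l 9 j = 0 ↔
    (l, j) ∈ [(2, 3), (2, 6), (3, 2), (3, 7), (6, 2), (6, 7), (7, 3), (7, 6)]) := by
  decide +kernel

theorem pIsospectral_iff (p : Fin 10) : PIsospectral p Γ₁ Γ₂ ↔ (p : ℕ) = 2 ∨ (p : ℕ) = 7 := by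
  constructor
  · intro h
    -- The eigenvalues 0 and 4π² already exclude every p other than 2 and 7: the former p = 1, 3, 5,
    -- 9, the latter p = 0, 4, 6, 8.
    have h0 := h 0
    rw [Γ₁, Γ₂, multiplicity_zero, multiplicity_zero, Nat.cast_inj, signCount_three_one,
      signCount_six_one] at h0
    have h1 : d Γ₁ p 1 = d Γ₂ p 1 := h _
    rw [d_one_three, d_one_six, Nat.cast_inj] at h1
    clear h
    revert p
    decide +kernel
  · intro h
    have h3 := signCount_three_one p
    have h3' := signCount_three_neg_one p
    have h6 := signCount_six_one p
    have h6' := signCount_six_neg_one p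
    -- In degrees 2 and 7 the 36 index sets split evenly, 18 of each sign, for both groups.
    have hv : ![1, 3, 18, 46, 60, 60, 46, 18, 3, 1] p = 18 ∧
        ![0, 6, 18, 38, 66, 66, 38, 18, 6, 0] p = 18 ∧
        ![1, 6, 18, 38, 60, 66, 46, 18, 3, 0] p = 18 ∧
        ![0, 3, 18, 46, 66, 60, 38, 18, 6, 1] p = 18 := by
      revert p
      decide +kernel
    exact pIsospectral_of_signCount (by norm_num) (by norm_num) (by rw [h3, h3', hv.1, hv.2.1])
      (by rw [h6, h6', hv.2.2.1, hv.2.2.2]) (by rw [h3, h6, hv.1, hv.2.2.1])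

end Values

end FlatForms
theorem mainTheorem9 :
    -- both quotients are compact flat 9-manifolds with translation lattice `Λ` and holonomy `ℤ₂`
    (FlatForms.IsBieberbach FlatForms.Γ₁ ∧ FlatForms.IsBieberbach FlatForms.Γ₂) ∧
    (∀ v : FlatForms.E 9,
      (FlatForms.translation v ∈ FlatForms.Γ₁ ↔ v ∈ FlatForms.canonicalLattice 9) ∧
      (FlatForms.translation v ∈ FlatForms.Γ₂ ↔ v ∈ FlatForms.canonicalLattice 9)) ∧
    Nonempty (FlatForms.holonomyGroup FlatForms.Γ₁ ≃* Multiplicative (ZMod 2)) ∧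
    Nonempty (FlatForms.holonomyGroup FlatForms.Γ₂ ≃* Multiplicative (ZMod 2)) ∧
    -- orientability
    FlatForms.Orientable FlatForms.Γ₁ ∧ ¬ FlatForms.Orientable FlatForms.Γ₂ ∧
    -- they are `p`-isospectral exactly for `p = 2` and `p = 7`
    (∀ p : ℕ, p ≤ 9 → (FlatForms.PIsospectral p FlatForms.Γ₁ FlatForms.Γ₂ ↔ p = 2 ∨ p = 7)) ∧
    -- Betti numbers
    (∀ p : Fin 10,
      FlatForms.betti FlatForms.Γ₁ p = ((![1, 3, 18, 46, 60, 60, 46, 18, 3, 1] p : ℕ) : Cardinal) ∧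
      FlatForms.betti FlatForms.Γ₂ p =
        ((![1, 6, 18, 38, 60, 66, 46, 18, 3, 0] p : ℕ) : Cardinal)) ∧
    -- multiplicities of the eigenvalue `4π²`
    FlatForms.d FlatForms.Γ₁ 0 1 < FlatForms.d FlatForms.Γ₂ 0 1 ∧
    (∀ p : ℕ, p = 4 ∨ p = 6 ∨ p = 8 →
      FlatForms.d FlatForms.Γ₁ p 1 ≠ FlatForms.d FlatForms.Γ₂ p 1) ∧
    -- zeros of Krawtchouk polynomials: `9` is the first odd dimension where there are any
    (∀ n l j : ℕ, Odd n → n < 9 → l ≤ n → j ≤ n → FlatForms.krawtchouk l n j ≠ 0) ∧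
    (∀ l j : ℕ, l ≤ 9 → j ≤ 9 →
      (FlatForms.krawtchouk l 9 j = 0 ↔
        (l, j) ∈ ({(2, 3), (2, 6), (3, 2), (3, 7), (6, 2), (6, 7), (7, 3), (7, 6)} :
          Set (ℕ × ℕ)))) := by
  refine ⟨⟨FlatForms.isBieberbach_diagGroup (by norm_num),
    FlatForms.isBieberbach_diagGroup (by norm_num)⟩,
    fun v => ⟨FlatForms.translation_mem_iff (by norm_num) (by norm_num) v,
      FlatForms.translation_mem_iff (by norm_num) (by norm_num) v⟩,
    FlatForms.nonempty_holonomyGroup_mulEquiv (by norm_num) (by norm_num),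
    FlatForms.nonempty_holonomyGroup_mulEquiv (by norm_num) (by norm_num),
    FlatForms.orientable_of_formSign (by decide +kernel),
    FlatForms.not_orientable_of_formSign (by decide +kernel),
    fun p hp => FlatForms.pIsospectral_iff ⟨p, by omega⟩,
    fun p => ⟨?_, ?_⟩, ?_, fun p hp => ?_,
    fun n l j hn h9 hl hj => FlatForms.krawtchouk_ne_zero n h9 hn l hl j hj,
    fun l j hl hj => ?_⟩
  · rw [FlatForms.Γ₁, FlatForms.betti_diagGroup (by norm_num), FlatForms.signCount_three_one]
  · rw [FlatForms.Γ₂, FlatForms.betti_diagGroup (by norm_num), FlatForms.signCount_six_one]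
  · have h1 := FlatForms.d_one_three 0
    have h2 := FlatForms.d_one_six 0
    rw [Fin.val_zero] at h1 h2
    rw [h1, h2, Nat.cast_lt]
    decide
  · have hp' : p < 10 := by omega
    have h1 := FlatForms.d_one_three ⟨p, hp'⟩
    have h2 := FlatForms.d_one_six ⟨p, hp'⟩
    dsimp only at h1 h2
    rw [h1, h2, Ne, Nat.cast_inj]
    clear h1 h2
    rcases hp with rfl | rfl | rfl <;> revert hp' <;> decide
  · rw [FlatForms.krawtchouk_nine_eq_zero_iff l hl j hj]
    simp
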